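/- Conventions. A polytope is the convex hull of a finite set of points; $\mathrm{vert}(P)$ is its vertex set; a facet is a face of dimension $\dim P-1$ (with $\dim\varnothing=-1$). Two polytopes are isomorphic if there is an inclusion-preserving bijection (in both directions) between their sets of faces. A polytope $P$ is $2$-level if every hyperplane $H$ that is facet-defining for $P$ has a parallel hyperplane containing all vertices of $P$ not in $H$. A simplicial core of a $d$-polytope $P$ is a tuple $\Gamma=(F_1,\dots,F_{d+1};v_1,\dots,v_{d+1})$ of facets $F_i$ and vertices $v_i$ of $P$ with $v_i\notin F_i$ and $v_j\in F_i$ for all $j>i$. The $\mathcal H$-embedding of $P$ with respect to $\Gamma$ is the image of $P$ under the affine map $\mathrm{aff}(P)\to\mathbb R^d$ with $v_j\mapsto e_j$ ($1\le j\le d$) and $v_{d+1}\mapsto 0$. For $E\subseteq[d]$ and $x\in\mathbb R^d$ write $x(E)=\sum_{i\in E}x_i$. Let $d\ge 1$, let $P_0$ be a $2$-level $(d-1)$-polytope and $\Gamma_0=(F'_2,\dots,F'_{d+1};v_2,\dots,v_{d+1})$ a simplicial core of $P_0$. Identify $P_0$ with its $\mathcal H$-embedding with respect to $\Gamma_0$,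 placed in $\{0\}\times\mathbb R^{d-1}\subseteq\mathbb R^d$ (so $v_j=e_j$ for $2\le j\le d$ and $v_{d+1}=0$). Let $M_{d-1}$ be the $(d-1)\times(d-1)$ matrix, with rows and columns indexed by $2,\dots,d$, whose $(i,j)$ entry is $0$ if $v_j\in F'_i$ and $1$ otherwise, and for $c\in\mathbb R^{d-1}$ let $$M_d(c)=\begin{pmatrix}1&0\\ c&M_{d-1}\end{pmatrix},\qquad \mathcal X_{\mathrm{full}}=\bigcup_{c\in\{0,1\}^{d-1}}M_d(c)^{-1}\cdot\bigl(\{1\}\times\{0,1\}^{d-1}\bigr).$$ For $A\subseteq\mathcal X_{\mathrm{full}}$ let $\mathrm{cl}_{\mathrm{dch}}(A)$ be the set of all $x\in\mathcal X_{\mathrm{full}}$ such that $0\le x(E)\le1$ for every nonempty $E\subseteq[d]$ that satisfies $0\le y(E)\le 1$ for all $y\in\mathrm{vert}(P_0)\cup A$. Three points $u,v,w$ are incompatible if, for some facet $F_0$ of $P_0$, the affine hull $\mathrm{aff}(F_0)$ and its translates containing $u$, $v$ and $w$ cannot be covered by any two parallel hyperplanes other than $\{0\}\times\mathbb R^{d-1}$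 and $\{1\}\times\mathbb R^{d-1}$. Let $\mathrm{cl}_{\mathrm{inc}}(A)=A$ if $\mathrm{vert}(P_0)\cup A$ contains no incompatible triple, and $\mathrm{cl}_{\mathrm{inc}}(A)=\mathcal X_{\mathrm{full}}$ otherwise. Put $\mathrm{cl}=\mathrm{cl}_{\mathrm{inc}}\circ\mathrm{cl}_{\mathrm{dch}}$; a set $A$ is closed if $\mathrm{cl}(A)=A$. Let $\mathcal F$ be the collection of nonempty $E\subseteq\{2,\dots,d\}$ such that $x(E)\ge0$ or $x(E)\le1$ defines a facet of $P_0$, let $\mathcal X_{\mathrm{inc}}=\{u\in\mathcal X_{\mathrm{full}} : u(E)\in\{-1,0,1\}\text{ for all }E\in\mathcal F\}$, and let $$\mathcal X=\{x\in\mathcal X_{\mathrm{inc}} : M_d(0)\,e_1\preccurlyeq M_d(0)\,x\},$$ where $\preccurlyeq$ is the lexicographic order on $\mathbb R^d$. Theorem. The collection $\mathcal A$ of all closed sets of $\mathrm{cl}$ that are contained in $\mathcal X$ is a complete family with respect to $P_0,\Gamma_0$. That is, every $A\in\mathcal A$ is a subset of $\mathcal X_{\mathrm{full}}$ with $e_1\in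 A$, and for every $2$-level $d$-polytope $P$ having a facet isomorphic to $P_0$ there are a set $A\in\mathcal A$ and a simplicial core $\Gamma$ of $P$ such that the $\mathcal H$-embedding of $P$ with respect to $\Gamma$ is $\mathrm{conv}(\mathrm{vert}(P_0)\cup A)$. -/

import Mathlib

namespace TwoLevel

open scoped Matrix

/-- A polytope: the convex hull of a finite set of points (possibly empty). -/
def IsPolytope {n : ℕ} (P : Set (Fin n → ℝ)) : Prop :=
  ∃ s : Finset (Fin n → ℝ), P = convexHull ℝ (s : Set (Fin n → ℝ))

/-- The dimension of (the affine hull of) a set, with `dim ∅ = -1`. -/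
noncomputable def dim {n : ℕ} (P : Set (Fin n → ℝ)) : ℤ :=
  open Classical in
  if P = ∅ then -1 else (Module.finrank ℝ (affineSpan ℝ P).direction : ℤ)

/-- The vertex set of a polytope. -/
def vert {n : ℕ} (P : Set (Fin n → ℝ)) : Set (Fin n → ℝ) :=
  P.extremePoints ℝ

/-- `F` is a facet of `P`: a face of dimension `dim P - 1`. (Faces of a polytope are its exposed
faces, with `∅` and `P` included.) -/
def IsFacet {n : ℕ} (P F : Set (Fin n → ℝ)) : Prop :=
  IsExposed ℝ P F ∧ dim F = dim P - 1

/-- Combinatorial isomorphism of polytopes: there is an inclusion-preserving bijection, in both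
directions, between their sets of faces. -/
def CombIso {m n : ℕ} (P : Set (Fin m → ℝ)) (Q : Set (Fin n → ℝ)) : Prop :=
  Nonempty ({F : Set (Fin m → ℝ) // IsExposed ℝ P F} ≃o {G : Set (Fin n → ℝ) // IsExposed ℝ Q G})

/-- `P` is 2-level: every facet-defining hyperplane `{f = c}` of `P` has a parallel hyperplane
`{f = c'}` containing all the vertices of `P` that are not in `{f = c}`. -/
def IsTwoLevel {n : ℕ} (P : Set (Fin n → ℝ)) : Prop :=
  ∀ (f : (Fin n → ℝ) →ₗ[ℝ] ℝ) (c : ℝ), f ≠ 0 → (∀ x ∈ P, c ≤ f x) →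
    IsFacet P {x ∈ P | f x = c} →
      ∃ c' : ℝ, ∀ x ∈ vert P, f x ≠ c → f x = c'

/-- `(F 0, …, F d; v 0, …, v d)` is a simplicial core of the `d`-polytope `P`. -/
structure IsSimplicialCore {d n : ℕ} (P : Set (Fin n → ℝ))
    (F : Fin (d + 1) → Set (Fin n → ℝ)) (v : Fin (d + 1) → Fin n → ℝ) : Prop where
  facet : ∀ i, IsFacet P (F i)
  vertex : ∀ i, v i ∈ vert P
  notMem : ∀ i, v i ∉ F i
  mem : ∀ i j, i < j → v j ∈ F i

/-- The affine map `ℝ^d → aff(v 0, …, v d)` sending the unit vector `e_j` to `v j` and the origin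
to the last point `v d`. -/
noncomputable def coreChart {d n : ℕ} (v : Fin (d + 1) → Fin n → ℝ) (x : Fin d → ℝ) :
    Fin n → ℝ :=
  v (Fin.last d) + ∑ j : Fin d, x j • (v j.castSucc - v (Fin.last d))

/-- The `ℋ`-embedding of the `d`-polytope `P` with respect to a simplicial core with vertices `v`:
the image of `P` under the affine map defined on `aff P` by `v j ↦ e_j` and `v d ↦ 0`. It is written
as the preimage of `P` under the inverse map; see `image_eq_hEmbedding`. -/
def hEmbedding {d n : ℕ} (P : Set (Fin n → ℝ)) (v : Fin (d + 1) → Fin n → ℝ) :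
    Set (Fin d → ℝ) :=
  {x | coreChart v x ∈ P}

theorem image_eq_hEmbedding {d n : ℕ} (P : Set (Fin n → ℝ)) (v : Fin (d + 1) → Fin n → ℝ)
    (φ : (Fin n → ℝ) →ᵃ[ℝ] (Fin d → ℝ)) (hφ : ∀ j : Fin d, φ (v j.castSucc) = Pi.single j 1)
    (hφ' : φ (v (Fin.last d)) = 0) (hP : P ⊆ affineSpan ℝ (Set.range v)) :
    φ '' P = hEmbedding P v := by
  have key : ∀ x, φ (coreChart v x) = x := by
    intro x
    have h1 : coreChart v x
        = (∑ j : Fin d, x j • (v j.castSucc - v (Fin.last d))) +ᵥ v (Fin.last d) := by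
      simp [coreChart, add_comm]
    have h2 : ∀ j : Fin d, φ.linear (v j.castSucc - v (Fin.last d)) = Pi.single j 1 := by
      intro j
      have := φ.linearMap_vsub (v j.castSucc) (v (Fin.last d))
      simpa [hφ, hφ'] using this
    rw [h1, φ.map_vadd, hφ', map_sum]
    simp only [map_smul, h2]
    ext i
    simp [Finset.sum_apply, Pi.single_apply]
  have hsurj : ∀ y ∈ affineSpan ℝ (Set.range v), ∃ x, coreChart v x = y := by
    intro y hy
    obtain ⟨w, hw, rfl⟩ := eq_affineCombination_of_mem_affineSpan_of_fintype hy
    refine ⟨fun j => w j.castSucc, ?_⟩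
    rw [Finset.affineCombination_eq_weightedVSubOfPoint_vadd_of_sum_eq_one _ _ _ hw
      (v (Fin.last d)), Finset.weightedVSubOfPoint_apply, Fin.sum_univ_castSucc]
    simp [coreChart, add_comm]
  ext x
  constructor
  · rintro ⟨y, hy, rfl⟩
    obtain ⟨z, rfl⟩ := hsurj y (hP hy)
    simpa [hEmbedding, key] using hy
  · intro hx
    exact ⟨_, hx, key x⟩

/-- The `ℋ`-embedding of the `k`-polytope `P₀`, placed in `{0} × ℝ^k ⊆ ℝ^(k+1)`. -/
def base {k m : ℕ} (P₀ : Set (Fin m → ℝ)) (v : Fin (k + 1) → Fin m → ℝ) :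
    Set (Fin (k + 1) → ℝ) :=
  (fun x : Fin k → ℝ => (Fin.cons 0 x : Fin (k + 1) → ℝ)) '' hEmbedding P₀ v

/-- The embedding transformation matrix of a simplicial core: the top left `k × k` submatrix of the
`0/1` slack matrix, whose `(i, j)` entry is `0` if `v j ∈ F i` and `1` otherwise. -/
noncomputable def coreMatrix {k m : ℕ} (F : Fin (k + 1) → Set (Fin m → ℝ))
    (v : Fin (k + 1) → Fin m → ℝ) : Matrix (Fin k) (Fin k) ℝ :=
  open Classical in
  Matrix.of fun i j => if v j.castSucc ∈ F i.castSucc then 0 else 1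

/-- The block matrix `M_d(c)` with first row `(1, 0, …, 0)` and `i`-th further row
`(c i, M i)`. -/
def extMatrix {k : ℕ} (M : Matrix (Fin k) (Fin k) ℝ) (c : Fin k → ℝ) :
    Matrix (Fin (k + 1)) (Fin (k + 1)) ℝ :=
  Matrix.of (Fin.cons (Fin.cons 1 0) (fun i => Fin.cons (c i) (M i)))

/-- The first unit vector `e_1` of `ℝ^(k+1)`. -/
def e₁ {k : ℕ} : Fin (k + 1) → ℝ := Pi.single 0 1

/-- The full ground set: the union over `c ∈ {0,1}^k` of `M_d(c)⁻¹ · ({1} × {0,1}^k)`. -/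
noncomputable def Xfull {k : ℕ} (M : Matrix (Fin k) (Fin k) ℝ) : Set (Fin (k + 1) → ℝ) :=
  {x | ∃ c y : Fin k → ℝ, (∀ i, c i = 0 ∨ c i = 1) ∧ (∀ i, y i = 0 ∨ y i = 1) ∧
    x = (extMatrix M c)⁻¹ *ᵥ (Fin.cons 1 y : Fin (k + 1) → ℝ)}

/-- The nonempty `E` whose slab `{x | 0 ≤ x(E) ≤ 1}` contains `S`, where `x(E) = ∑ i ∈ E, x i`. -/
def hyperedges {d : ℕ} (S : Set (Fin d → ℝ)) : Set (Finset (Fin d)) :=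
  {E | E.Nonempty ∧ ∀ x ∈ S, 0 ≤ ∑ i ∈ E, x i ∧ ∑ i ∈ E, x i ≤ 1}

/-- The discrete convex hull operator on subsets of the full ground set. -/
noncomputable def clDch {k : ℕ} (M : Matrix (Fin k) (Fin k) ℝ) (B : Set (Fin (k + 1) → ℝ))
    (A : Set (Fin (k + 1) → ℝ)) : Set (Fin (k + 1) → ℝ) :=
  {x ∈ Xfull M | ∀ E ∈ hyperedges (vert B ∪ A), 0 ≤ ∑ i ∈ E, x i ∧ ∑ i ∈ E, x i ≤ 1}

/-- The translate of the affine hull of `F` that contains `u`. -/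
def affTranslate {d : ℕ} (F : Set (Fin d → ℝ)) (u : Fin d → ℝ) : Set (Fin d → ℝ) :=
  {x | x - u ∈ (affineSpan ℝ F).direction}

/-- The points `u, v, w` are incompatible: for some facet `F₀` of the base `B`, the affine hull of
`F₀` and its translates through `u`, `v`, `w` cannot be covered by two parallel hyperplanes
`{f = a}`, `{f = b}` other than `{0} × ℝ^k` and `{1} × ℝ^k`. -/
def Incompatible {k : ℕ} (B : Set (Fin (k + 1) → ℝ)) (u v w : Fin (k + 1) → ℝ) : Prop :=
  ∃ F₀ : Set (Fin (k + 1) → ℝ), IsFacet B F₀ ∧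
    ¬ ∃ (f : (Fin (k + 1) → ℝ) →ₗ[ℝ] ℝ) (a b : ℝ), f ≠ 0 ∧
      ({{x | f x = a}, {x | f x = b}} : Set (Set (Fin (k + 1) → ℝ))) ≠
        {{x | x 0 = 0}, {x | x 0 = 1}} ∧
      (affineSpan ℝ F₀ : Set (Fin (k + 1) → ℝ)) ∪ affTranslate F₀ u ∪ affTranslate F₀ v ∪
        affTranslate F₀ w ⊆ {x | f x = a} ∪ {x | f x = b}

/-- The incompatibility operator on subsets of the full ground set. -/
noncomputable def clInc {k : ℕ} (M : Matrix (Fin k) (Fin k) ℝ) (B : Set (Fin (k + 1) → ℝ))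
    (A : Set (Fin (k + 1) → ℝ)) : Set (Fin (k + 1) → ℝ) :=
  open Classical in
  if ∃ u ∈ vert B ∪ A, ∃ v ∈ vert B ∪ A, ∃ w ∈ vert B ∪ A, Incompatible B u v w
  then Xfull M else A

/-- The final operator `cl = cl_inc ∘ cl_dch`. -/
noncomputable def cl {k : ℕ} (M : Matrix (Fin k) (Fin k) ℝ) (B : Set (Fin (k + 1) → ℝ))
    (A : Set (Fin (k + 1) → ℝ)) : Set (Fin (k + 1) → ℝ) :=
  clInc M B (clDch M B A)

/-- The nonempty `E` not containing the first index such that `x(E) ≥ 0` or `x(E) ≤ 1` defines a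
facet of `B`. -/
def facetEdges {k : ℕ} (B : Set (Fin (k + 1) → ℝ)) : Set (Finset (Fin (k + 1))) :=
  {E | E.Nonempty ∧ 0 ∉ E ∧
    (((∀ x ∈ B, 0 ≤ ∑ i ∈ E, x i) ∧ IsFacet B {x ∈ B | ∑ i ∈ E, x i = 0}) ∨
      ((∀ x ∈ B, ∑ i ∈ E, x i ≤ 1) ∧ IsFacet B {x ∈ B | ∑ i ∈ E, x i = 1}))}

/-- The points `u` of the full ground set with `u(E) ∈ {-1, 0, 1}` for all `E ∈ facetEdges B`. -/
noncomputable def Xinc {k : ℕ} (M : Matrix (Fin k) (Fin k) ℝ) (B : Set (Fin (k + 1) → ℝ)) :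
    Set (Fin (k + 1) → ℝ) :=
  {u ∈ Xfull M | ∀ E ∈ facetEdges B,
    ∑ i ∈ E, u i = -1 ∨ ∑ i ∈ E, u i = 0 ∨ ∑ i ∈ E, u i = 1}

/-- The reduced ground set: the points `x` of `Xinc` such that `M_d(0) e_1` is lexicographically at
most `M_d(0) x`. -/
noncomputable def reducedX {k : ℕ} (M : Matrix (Fin k) (Fin k) ℝ)
    (B : Set (Fin (k + 1) → ℝ)) : Set (Fin (k + 1) → ℝ) :=
  {x ∈ Xinc M B | toLex (extMatrix M 0 *ᵥ e₁) ≤ toLex (extMatrix M 0 *ᵥ x)}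

/-- The family `𝒜` of subsets of the full ground set is complete with respect to the `k`-polytope
`P₀` and its simplicial core `(F; v)`: each member contains `e_1`, and every 2-level
`(k+1)`-polytope with a facet isomorphic to `P₀` has an `ℋ`-embedding (with respect to one of its
simplicial cores) of the form `conv (vert P₀ ∪ A)` with `A ∈ 𝒜`. -/
def IsCompleteFamily {k m : ℕ} (P₀ : Set (Fin m → ℝ)) (F : Fin (k + 1) → Set (Fin m → ℝ))
    (v : Fin (k + 1) → Fin m → ℝ) (𝒜 : Set (Set (Fin (k + 1) → ℝ))) : Prop :=
  (∀ A ∈ 𝒜, A ⊆ Xfull (coreMatrix F v)) ∧ (∀ A ∈ 𝒜, e₁ ∈ A) ∧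
  ∀ (n : ℕ) (P : Set (Fin n → ℝ)), IsPolytope P → dim P = (k : ℤ) + 1 → IsTwoLevel P →
    (∃ G, IsFacet P G ∧ CombIso G P₀) →
    ∃ A ∈ 𝒜, ∃ (F' : Fin (k + 1 + 1) → Set (Fin n → ℝ)) (v' : Fin (k + 1 + 1) → Fin n → ℝ),
      IsSimplicialCore P F' v' ∧ hEmbedding P v' = convexHull ℝ (vert (base P₀ v) ∪ A)

end TwoLevel

/-!
The proof works with slack functionals: affine functionals with values `0` and `1` at the vertices
of a 2-level polytope `P` that vanish exactly on a given facet. Every functional that is nonnegative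
on a polytope can be pushed to a facet-defining one without losing zeros
(`IsPolytope.exists_facet`). This single statement shows that slack functionals cut `P` out of its
affine hull (`IsTwoLevel.exists_neg`), that every proper face of a facet `G` lies in a second facet
(`IsTwoLevel.exists_extension`), and that facets are the maximal proper faces, so that a
combinatorial isomorphism carries facets to facets, vertices to vertices, and a simplicial core of
`P₀` to one of `G` (`CombIso.exists_maps`).

In the coordinates of a simplicial core the slacks of the core facets are the entries of `M x`, where
the embedding matrix `M` is unit lower triangular. Hence the coordinates of the vertices, and with
them the `ℋ`-embedding, depend only on the incidences, and `G` and `P₀` have the same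
`ℋ`-embedding (`setOf_coreChart_mem_vert_eq`). The core of `G` extends to one of `P`: each core
facet of `G` lies in a second facet of `P`, and the additional vertex may be any vertex off `G`. It
is chosen with lexicographically minimal slack vector (`exists_isCoreExtension`).

The closed set belonging to `P` is the set `A` of the vertices of its `ℋ`-embedding at height one
(`upperVert`).

* It is closed under the discrete convex hull, since a point of the ground set in the `ℋ`-embedding
  is integral, so its core slacks are integers in `[0, 1]`, which makes it a vertex
  (`IsCoreExtension.clDch_upperVert`).
* It creates no incompatible triple: a facet `F₀` of the base lies in a second facet, whose
  hyperplane and a parallel one contain all vertices (`IsCoreExtension.not_incompatible`).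
* It lies in the reduced ground set. A facet inequality of the base is the restriction of a facet
  inequality of the whole, which changes its value at height one by `0` or `1`
  (`IsCoreExtension.sum_mem_of_isFacet`); the lexicographic condition is the choice of the
  additional vertex, as `extMatrix M 0` and the slack map differ by a translation at height one.
-/

namespace TwoLevel

open scoped Matrix

/-! ### Dimension and affine functionals -/

theorem vectorSpan_le_ker {n : ℕ} {S : Set (Fin n → ℝ)} (s : (Fin n → ℝ) →ᵃ[ℝ] ℝ) {a : ℝ}
    (hs : ∀ x ∈ S, s x = a) : vectorSpan ℝ S ≤ LinearMap.ker s.linear := by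
  rw [vectorSpan_def, Submodule.span_le]
  rintro _ ⟨x, hx, y, hy, rfl⟩
  have := s.linearMap_vsub x y
  simp only [vsub_eq_sub] at this
  simp [this, hs x hx, hs y hy]

theorem dim_of_nonempty {n : ℕ} {S : Set (Fin n → ℝ)} (h : S.Nonempty) :
    dim S = (Module.finrank ℝ (vectorSpan ℝ S) : ℤ) := by
  rw [dim, if_neg h.ne_empty, direction_affineSpan]

theorem dim_empty {n : ℕ} : dim (∅ : Set (Fin n → ℝ)) = -1 := by
  simp [dim]

theorem dim_nonneg {n : ℕ} {S : Set (Fin n → ℝ)} (h : S.Nonempty) : 0 ≤ dim S := by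
  rw [dim_of_nonempty h]; positivity

theorem neg_one_le_dim {n : ℕ} (S : Set (Fin n → ℝ)) : -1 ≤ dim S := by
  rcases S.eq_empty_or_nonempty with rfl | h
  · rw [dim_empty]
  · linarith [dim_nonneg h]

theorem nonempty_of_dim_nonneg {n : ℕ} {S : Set (Fin n → ℝ)} (h : 0 ≤ dim S) : S.Nonempty := by
  by_contra hS
  rw [Set.not_nonempty_iff_eq_empty] at hS
  rw [hS, dim_empty] at h
  omega

theorem dim_convexHull {n : ℕ} (S : Set (Fin n → ℝ)) : dim (convexHull ℝ S) = dim S := by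
  have h : affineSpan ℝ (convexHull ℝ S) = affineSpan ℝ S := affineSpan_convexHull S
  unfold dim
  rw [h]
  simp

theorem dim_mono {n : ℕ} {S T : Set (Fin n → ℝ)} (h : S ⊆ T) : dim S ≤ dim T := by
  rcases S.eq_empty_or_nonempty with rfl | hS
  · rw [dim_empty]; exact neg_one_le_dim T
  · rw [dim_of_nonempty hS, dim_of_nonempty (hS.mono h)]
    exact_mod_cast Submodule.finrank_mono (vectorSpan_mono ℝ h)

/-- A subset on which an affine functional vanishes has smaller dimension, if the functional is not
zero on the whole affine hull. -/
theorem dim_lt {n : ℕ} {S T : Set (Fin n → ℝ)} (h : S ⊆ T) (s : (Fin n → ℝ) →ᵃ[ℝ] ℝ)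
    (hs : ∀ x ∈ S, s x = 0) {u : Fin n → ℝ} (hu : u ∈ affineSpan ℝ T) (hsu : s u ≠ 0) :
    dim S < dim T := by
  have hT : T.Nonempty := (affineSpan_nonempty ℝ).1 ⟨u, hu⟩
  rcases S.eq_empty_or_nonempty with rfl | hS
  · rw [dim_empty]; linarith [dim_nonneg hT]
  · rw [dim_of_nonempty hS, dim_of_nonempty hT]
    have hlt : vectorSpan ℝ S < vectorSpan ℝ T := by
      refine lt_of_le_of_ne (vectorSpan_mono ℝ h) fun heq => ?_
      obtain ⟨p, hp⟩ := hS
      have h1 : u -ᵥ p ∈ vectorSpan ℝ T := by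
        rw [← direction_affineSpan]
        exact AffineSubspace.vsub_mem_direction hu (mem_affineSpan ℝ (h hp))
      rw [← heq] at h1
      have h2 := vectorSpan_le_ker s hs h1
      rw [LinearMap.mem_ker, s.linearMap_vsub, hs p hp] at h2
      simp at h2
      exact hsu h2
    exact_mod_cast Submodule.finrank_lt_finrank_of_lt hlt

/-- Two affine functionals that vanish on a subset of codimension one are proportional. -/
theorem eq_mul_of_dim {n : ℕ} {S T : Set (Fin n → ℝ)} (h : S ⊆ T) (hd : dim T ≤ dim S + 1)
    (s g : (Fin n → ℝ) →ᵃ[ℝ] ℝ) (hs : ∀ x ∈ S, s x = 0) (hg : ∀ x ∈ S, g x = 0)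
    {u : Fin n → ℝ} (hu : u ∈ T) (hsu : s u ≠ 0) {x : Fin n → ℝ} (hx : x ∈ T) :
    g x = g u / s u * s x := by
  have hT : T.Nonempty := ⟨u, hu⟩
  have hsub : insert u S ⊆ T := Set.insert_subset hu h
  have h1 : dim S < dim (insert u S) :=
    dim_lt (Set.subset_insert _ _) s hs (mem_affineSpan ℝ (Set.mem_insert _ _)) hsu
  have h2 : vectorSpan ℝ (insert u S) = vectorSpan ℝ T := by
    refine Submodule.eq_of_le_of_finrank_le (vectorSpan_mono ℝ hsub) ?_
    have : dim T ≤ dim (insert u S) := by omega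
    rw [dim_of_nonempty hT, dim_of_nonempty (Set.insert_nonempty _ _)] at this
    exact_mod_cast this
  let q : (Fin n → ℝ) →ᵃ[ℝ] ℝ := g - (g u / s u) • s
  have hq : ∀ y ∈ insert u S, q y = 0 := by
    intro y hy
    rcases hy with rfl | hy
    · simp [q, hsu]
    · simp [q, hs y hy, hg y hy]
  have h3 : x -ᵥ u ∈ vectorSpan ℝ (insert u S) := by
    rw [h2]; exact vsub_mem_vectorSpan ℝ hx hu
  have h4 := vectorSpan_le_ker q hq h3
  rw [LinearMap.mem_ker, q.linearMap_vsub, hq u (Set.mem_insert _ _)] at h4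
  simp [q] at h4
  linarith

/-- If `insert x S` does not affinely span `T`, some affine functional vanishes on it but not on
`T`. -/
theorem exists_affine_of_dim {n : ℕ} {S T : Set (Fin n → ℝ)} (hd : dim S + 1 < dim T)
    {x : Fin n → ℝ} :
    ∃ g : (Fin n → ℝ) →ᵃ[ℝ] ℝ, (∀ y ∈ S, g y = 0) ∧ g x = 0 ∧ ∃ v ∈ T, g v < 0 := by
  have hT : T.Nonempty := nonempty_of_dim_nonneg (by linarith [neg_one_le_dim S])
  have hlt : dim (insert x S) < dim T := by
    rcases S.eq_empty_or_nonempty with rfl | hS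
    · rw [dim_of_nonempty (Set.insert_nonempty _ _)]
      rw [dim_empty] at hd
      have h0 : vectorSpan ℝ (insert x (∅ : Set (Fin n → ℝ))) = ⊥ := by simp
      rw [h0]
      simpa using hd
    · rw [dim_of_nonempty (Set.insert_nonempty _ _)]
      rw [dim_of_nonempty hS] at hd
      have := finrank_vectorSpan_insert_le_set ℝ S x
      omega
  obtain ⟨v, hv, hvx⟩ : ∃ v ∈ T, v -ᵥ x ∉ vectorSpan ℝ (insert x S) := by
    by_contra! hcon
    have : vectorSpan ℝ T ≤ vectorSpan ℝ (insert x S) := by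
      rw [vectorSpan_def, Submodule.span_le]
      rintro _ ⟨a, ha, b, hb, rfl⟩
      have := Submodule.sub_mem _ (hcon a ha) (hcon b hb)
      simpa using this
    rw [dim_of_nonempty (Set.insert_nonempty _ _), dim_of_nonempty hT] at hlt
    have := Submodule.finrank_mono this
    omega
  obtain ⟨l, hl, hl'⟩ := Submodule.exists_le_ker_of_notMem hvx
  let g : (Fin n → ℝ) →ᵃ[ℝ] ℝ := l.toAffineMap - AffineMap.const ℝ _ (l x)
  have hg : ∀ y, g y = l (y - x) := by intro y; simp [g]
  have hS : ∀ y ∈ S, g y = 0 := by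
    intro y hy
    rw [hg]
    exact hl' (vsub_mem_vectorSpan ℝ (Set.mem_insert_of_mem _ hy) (Set.mem_insert _ _))
  have hgv : g v ≠ 0 := by rw [hg]; exact hl
  rcases lt_or_gt_of_ne hgv with h0 | h0
  · exact ⟨g, hS, by simp [hg], v, hv, h0⟩
  · exact ⟨-g, fun y hy => by simp [hS y hy], by simp [hg], v, hv, by simpa using h0⟩

/-- Every nonnegative functional on a finite point set can be pushed to a facet-defining one,
keeping its zeros and its value at a prescribed point: as long as the zeros span too little, adding
a multiple of a functional that vanishes on them and on the given point creates a new zero. -/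
theorem exists_facet_functional {n : ℕ} (V : Finset (Fin n → ℝ)) (x : Fin n → ℝ) (N : ℕ) :
    ∀ f : (Fin n → ℝ) →ᵃ[ℝ] ℝ, (∀ v ∈ V, 0 ≤ f v) → f x ≠ 0 →
      (V.filter fun v => f v ≠ 0).card ≤ N →
      ∃ f' : (Fin n → ℝ) →ᵃ[ℝ] ℝ, (∀ v ∈ V, 0 ≤ f' v) ∧ (∀ v ∈ V, f v = 0 → f' v = 0) ∧
        f' x = f x ∧ dim (V : Set (Fin n → ℝ)) ≤ dim {v | v ∈ V ∧ f' v = 0} + 1 := by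
  induction N with
  | zero =>
    intro f hf hx hN
    refine ⟨f, hf, fun _ _ h => h, rfl, ?_⟩
    have : (V : Set (Fin n → ℝ)) ⊆ {v | v ∈ V ∧ f v = 0} := by
      intro v hv
      refine ⟨hv, ?_⟩
      by_contra h0
      have : v ∈ V.filter fun v => f v ≠ 0 := Finset.mem_filter.2 ⟨hv, h0⟩
      rw [Finset.card_eq_zero.1 (Nat.le_zero.1 hN)] at this
      simp at this
    linarith [dim_mono this]
  | succ N ih =>
    intro f hf hx hN
    by_cases hd : dim (V : Set (Fin n → ℝ)) ≤ dim {v | v ∈ V ∧ f v = 0} + 1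
    · exact ⟨f, hf, fun _ _ h => h, rfl, hd⟩
    push Not at hd
    obtain ⟨g, hg, hgx, w, hw, hgw⟩ := exists_affine_of_dim (x := x) hd
    have hne : (V.filter fun v => g v < 0).Nonempty := ⟨w, Finset.mem_filter.2 ⟨hw, hgw⟩⟩
    obtain ⟨u, hu, hmin⟩ := Finset.exists_min_image _ (fun v => f v / -g v) hne
    rw [Finset.mem_filter] at hu
    -- the largest step that keeps the functional nonnegative
    set t := f u / -g u with ht
    have ht0 : 0 ≤ t := div_nonneg (hf u hu.1) (by linarith [hu.2])
    have hval : ∀ v, (f + t • g) v = f v + t * g v := fun v => by simp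
    have hnn : ∀ v ∈ V, 0 ≤ (f + t • g) v := by
      intro v hv
      rw [hval]
      rcases lt_or_ge (g v) 0 with h0 | h0
      · have := hmin v (Finset.mem_filter.2 ⟨hv, h0⟩)
        rw [le_div_iff₀ (by linarith)] at this
        linarith
      · have := hf v hv
        positivity
    have hz : ∀ v ∈ V, f v = 0 → (f + t • g) v = 0 := by
      intro v hv h0
      rw [hval, h0, hg v ⟨hv, h0⟩]; simp
    have hu0 : (f + t • g) u = 0 := by
      rw [hval, ht]
      have := hu.2.ne
      field_simp
      ring
    have hfu : f u ≠ 0 := fun h0 => hu.2.ne (hg u ⟨hu.1, h0⟩)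
    have hcard : (V.filter fun v => (f + t • g) v ≠ 0).card < (V.filter fun v => f v ≠ 0).card := by
      apply Finset.card_lt_card
      rw [Finset.ssubset_iff_of_subset]
      · exact ⟨u, Finset.mem_filter.2 ⟨hu.1, hfu⟩, fun h => (Finset.mem_filter.1 h).2 hu0⟩
      · intro v hv
        rw [Finset.mem_filter] at hv ⊢
        exact ⟨hv.1, fun h0 => hv.2 (hz v hv.1 h0)⟩
    have hxx : (f + t • g) x = f x := by rw [hval, hgx]; simp
    obtain ⟨f', h1, h2, h3, h4⟩ := ih (f + t • g) hnn (by rw [hxx]; exact hx) (by omega)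
    exact ⟨f', h1, fun v hv h0 => h2 v hv (hz v hv h0), h3.trans hxx, h4⟩

theorem nonneg_of_mem_convexHull {n : ℕ} {S : Set (Fin n → ℝ)} (f : (Fin n → ℝ) →ᵃ[ℝ] ℝ)
    (hf : ∀ v ∈ S, 0 ≤ f v) {x : Fin n → ℝ} (hx : x ∈ convexHull ℝ S) : 0 ≤ f x := by
  have : convexHull ℝ S ⊆ f ⁻¹' Set.Ici 0 :=
    convexHull_min hf ((convex_Ici 0).affine_preimage f)
  exact this hx

/-! ### Faces of polytopes -/

theorem isExposed_of_nonneg {n : ℕ} {P : Set (Fin n → ℝ)} (g : (Fin n → ℝ) →ᵃ[ℝ] ℝ)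
    (hg : ∀ x ∈ P, 0 ≤ g x) : IsExposed ℝ P {x ∈ P | g x = 0} := by
  rintro ⟨p, hp, hp0⟩
  refine ⟨-(LinearMap.toContinuousLinearMap g.linear), ?_⟩
  have hsub : ∀ x y, g.linear x - g.linear y = g x - g y := by
    intro x y
    have := g.linearMap_vsub x y
    simpa using this
  ext x
  simp only [Set.mem_ofPred_eq]
  constructor
  · rintro ⟨hx, h0⟩
    refine ⟨hx, fun y hy => ?_⟩
    have := hsub x y
    have := hg y hy
    simp
    linarith
  · rintro ⟨hx, h⟩
    refine ⟨hx, le_antisymm ?_ (hg x hx)⟩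
    have h1 := h p hp
    have := hsub x p
    simp at h1
    linarith

/-- Exposed faces, including the empty one, are the zero sets of nonnegative affine functionals. -/
theorem exists_nonneg_of_isExposed {n : ℕ} {P F : Set (Fin n → ℝ)} (h : IsExposed ℝ P F) :
    ∃ g : (Fin n → ℝ) →ᵃ[ℝ] ℝ, (∀ x ∈ P, 0 ≤ g x) ∧ F = {x ∈ P | g x = 0} := by
  rcases F.eq_empty_or_nonempty with rfl | hF
  · refine ⟨AffineMap.const ℝ _ 1, by simp, by simp⟩
  · obtain ⟨l, hl⟩ := h hF
    obtain ⟨p, hp⟩ := hF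
    rw [hl] at hp
    refine ⟨AffineMap.const ℝ _ (l p) - (l : (Fin n → ℝ) →ₗ[ℝ] ℝ).toAffineMap, ?_, ?_⟩
    · intro x hx
      simpa using hp.2 x hx
    · rw [hl]
      ext x
      constructor
      · rintro ⟨hx, h1⟩
        exact ⟨hx, by simpa [sub_eq_zero] using le_antisymm (h1 p hp.1) (hp.2 x hx)⟩
      · rintro ⟨hx, h1⟩
        have : l p = l x := by simpa [sub_eq_zero] using h1
        exact ⟨hx, fun y hy => this ▸ hp.2 y hy⟩

theorem IsPolytope.convex {n : ℕ} {P : Set (Fin n → ℝ)} (h : IsPolytope P) : Convex ℝ P := by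
  obtain ⟨s, rfl⟩ := h
  exact convex_convexHull ℝ _

theorem IsPolytope.isCompact {n : ℕ} {P : Set (Fin n → ℝ)} (h : IsPolytope P) : IsCompact P := by
  obtain ⟨s, rfl⟩ := h
  exact s.finite_toSet.isCompact_convexHull ℝ

theorem IsPolytope.finite_vert {n : ℕ} {P : Set (Fin n → ℝ)} (h : IsPolytope P) :
    (vert P).Finite := by
  obtain ⟨s, rfl⟩ := h
  exact s.finite_toSet.subset extremePoints_convexHull_subset

theorem IsPolytope.convexHull_vert {n : ℕ} {P : Set (Fin n → ℝ)} (h : IsPolytope P) :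
    convexHull ℝ (vert P) = P := by
  rw [← (h.finite_vert.isClosed_convexHull ℝ).closure_eq]
  exact closure_convexHull_extremePoints h.isCompact h.convex

theorem vert_subset {n : ℕ} {P : Set (Fin n → ℝ)} : vert P ⊆ P := extremePoints_subset

theorem vert_subset_of_isExposed {n : ℕ} {P F : Set (Fin n → ℝ)} (h : IsExposed ℝ P F) :
    vert F ⊆ vert P :=
  h.isExtreme.extremePoints_subset_extremePoints

theorem IsPolytope.nonneg {n : ℕ} {P : Set (Fin n → ℝ)} (h : IsPolytope P)
    (f : (Fin n → ℝ) →ᵃ[ℝ] ℝ) (hf : ∀ v ∈ vert P, 0 ≤ f v) {x : Fin n → ℝ} (hx : x ∈ P) :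
    0 ≤ f x := by
  rw [← h.convexHull_vert] at hx
  exact nonneg_of_mem_convexHull f hf hx

theorem IsPolytope.eq_zero {n : ℕ} {P : Set (Fin n → ℝ)} (h : IsPolytope P)
    (f : (Fin n → ℝ) →ᵃ[ℝ] ℝ) (hf : ∀ v ∈ vert P, f v = 0) {x : Fin n → ℝ} (hx : x ∈ P) :
    f x = 0 := by
  refine le_antisymm ?_ (h.nonneg f (fun v hv => (hf v hv).ge) hx)
  have := h.nonneg (-f) (fun v hv => by simp [hf v hv]) hx
  simpa using this

/-- A functional that is nonnegative on a polytope, and nonzero at a point of its affine hull, can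
be replaced by one that defines a facet, without losing zeros and with the same value there. -/
theorem IsPolytope.exists_facet {n : ℕ} {P : Set (Fin n → ℝ)} (h : IsPolytope P)
    (f : (Fin n → ℝ) →ᵃ[ℝ] ℝ) (hf : ∀ v ∈ P, 0 ≤ f v) {x : Fin n → ℝ}
    (hx : x ∈ affineSpan ℝ P) (hfx : f x ≠ 0) :
    ∃ f' : (Fin n → ℝ) →ᵃ[ℝ] ℝ, (∀ v ∈ P, 0 ≤ f' v) ∧ (∀ v ∈ P, f v = 0 → f' v = 0) ∧
      f' x = f x ∧ IsFacet P {v ∈ P | f' v = 0} := by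
  obtain ⟨f', h1, h2, h3, h4⟩ := exists_facet_functional h.finite_vert.toFinset x _ f
    (fun v hv => hf v (vert_subset (by simpa using hv))) hfx le_rfl
  simp only [Set.Finite.mem_toFinset, Set.Finite.coe_toFinset] at h1 h2 h4
  have h1' : ∀ v ∈ P, 0 ≤ f' v := fun v hv => h.nonneg f' h1 hv
  refine ⟨f', h1', ?_, h3, isExposed_of_nonneg f' h1', ?_⟩
  · -- `f'` is dominated by a multiple of `f` on the finitely many vertices, hence on `P`
    intro v hv hv0
    let C : ℝ := ∑ u ∈ h.finite_vert.toFinset, f' u / f u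
    have hC : ∀ u ∈ vert P, f' u ≤ C * f u := by
      intro u hu
      rcases eq_or_lt_of_le (hf u (vert_subset hu)) with h0 | h0
      · rw [h2 u hu h0.symm, ← h0]; simp
      · rw [← div_le_iff₀ h0]
        refine Finset.single_le_sum (f := fun u => f' u / f u) (fun w hw => ?_) (by simpa using hu)
        have hw' : w ∈ vert P := by simpa using hw
        exact div_nonneg (h1 w hw') (hf w (vert_subset hw'))
    have := h.nonneg (C • f - f') (fun u hu => by simpa using hC u hu) hv
    simp [hv0] at this
    exact le_antisymm this (h1' v hv)
  · have hlt : dim {v ∈ P | f' v = 0} < dim P :=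
      dim_lt (Set.sep_subset _ _) f' (fun y hy => hy.2) hx (by rw [h3]; exact hfx)
    have hle : dim {v | v ∈ vert P ∧ f' v = 0} ≤ dim {v ∈ P | f' v = 0} :=
      dim_mono fun v hv => ⟨vert_subset hv.1, hv.2⟩
    have : dim (vert P) = dim P := by rw [← dim_convexHull, h.convexHull_vert]
    omega

theorem IsPolytope.singleton_isExposed {n : ℕ} {P : Set (Fin n → ℝ)} (h : IsPolytope P)
    {u : Fin n → ℝ} (hu : u ∈ vert P) : IsExposed ℝ P {u} := by
  have hconv : Convex ℝ (P \ {u}) :=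
    (h.convex.mem_extremePoints_iff_convex_sdiff.1 hu).2
  have hsub : convexHull ℝ (vert P \ {u}) ⊆ P \ {u} :=
    convexHull_min (Set.sdiff_subset_sdiff_left vert_subset) hconv
  have hnot : u ∉ convexHull ℝ (vert P \ {u}) := fun hc => (hsub hc).2 rfl
  obtain ⟨l, a, hla, hl⟩ := geometric_hahn_banach_point_closed (convex_convexHull ℝ _)
    ((h.finite_vert.subset Set.sdiff_subset).isClosed_convexHull ℝ) hnot
  let g : (Fin n → ℝ) →ᵃ[ℝ] ℝ := (l : (Fin n → ℝ) →ₗ[ℝ] ℝ).toAffineMap - AffineMap.const ℝ _ (l u)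
  have hg : ∀ x, g x = l x - l u := fun x => by simp [g]
  have hpos : ∀ v ∈ vert P, v ≠ u → 0 < g v := by
    intro v hv hne
    have := hl v (subset_convexHull ℝ _ ⟨hv, hne⟩)
    rw [hg]; linarith
  have hnn : ∀ v ∈ vert P, 0 ≤ g v := by
    intro v hv
    by_cases hne : v = u
    · rw [hg, hne]; simp
    · exact (hpos v hv hne).le
  have hex := isExposed_of_nonneg g (fun x hx => h.nonneg g hnn hx)
  -- the exposed face has no vertex besides `u`
  have hE : {x ∈ P | g x = 0} = {u} := by
    have hcl : IsCompact {x ∈ P | g x = 0} := hex.isCompact h.isCompact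
    have hcv : Convex ℝ {x ∈ P | g x = 0} := hex.convex h.convex
    have hv : vert {x ∈ P | g x = 0} ⊆ {u} := by
      intro w hw
      by_contra hne
      have := hpos w (vert_subset_of_isExposed hex hw) hne
      have := (vert_subset hw).2
      linarith
    apply Set.Subset.antisymm
    · rw [← closure_convexHull_extremePoints hcl hcv]
      refine closure_minimal (convexHull_min hv (convex_singleton u)) isClosed_singleton
    · rintro _ rfl
      exact ⟨vert_subset hu, by simp [hg]⟩
  rw [← hE]; exact hex

theorem isExposed_isPolytope {n : ℕ} {P F : Set (Fin n → ℝ)} (h : IsPolytope P)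
    (hF : IsExposed ℝ P F) : IsPolytope F := by
  have hfin : (vert F).Finite := h.finite_vert.subset (vert_subset_of_isExposed hF)
  refine ⟨hfin.toFinset, ?_⟩
  rw [hfin.coe_toFinset, ← (hfin.isClosed_convexHull ℝ).closure_eq]
  exact (closure_convexHull_extremePoints (hF.isCompact h.isCompact) (hF.convex h.convex)).symm

/-! ### Slack functionals of 2-level polytopes -/

/-- `s` is a normalized slack functional of the facet `F` of `P`: it takes only the values `0` and
`1` at the vertices, and vanishes exactly at those on `F`. -/
structure IsSlack {n : ℕ} (P F : Set (Fin n → ℝ)) (s : (Fin n → ℝ) →ᵃ[ℝ] ℝ) : Prop where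
  zero_or_one : ∀ v ∈ vert P, s v = 0 ∨ s v = 1
  eq_zero_iff : ∀ v ∈ vert P, s v = 0 ↔ v ∈ F

theorem IsFacet.subset {n : ℕ} {P F : Set (Fin n → ℝ)} (h : IsFacet P F) : F ⊆ P := h.1.subset

theorem IsFacet.ne {n : ℕ} {P F : Set (Fin n → ℝ)} (h : IsFacet P F) : F ≠ P := by
  intro he
  have := h.2
  rw [he] at this
  omega

theorem IsPolytope.vert_nonempty {n : ℕ} {P : Set (Fin n → ℝ)} (h : IsPolytope P)
    (hne : P.Nonempty) : (vert P).Nonempty := by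
  rw [← h.convexHull_vert] at hne
  exact convexHull_nonempty_iff.1 hne

/-- An affine functional with values `0` and `1` at the vertices has values in `[0, 1]`. -/
theorem IsPolytope.mem_Icc {n : ℕ} {P : Set (Fin n → ℝ)} (h : IsPolytope P)
    {s : (Fin n → ℝ) →ᵃ[ℝ] ℝ} (hs : ∀ v ∈ vert P, s v = 0 ∨ s v = 1) {x : Fin n → ℝ}
    (hx : x ∈ P) : 0 ≤ s x ∧ s x ≤ 1 := by
  constructor
  · exact h.nonneg s (fun v hv => by rcases hs v hv with h | h <;> rw [h]; norm_num) hx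
  · have := h.nonneg (AffineMap.const ℝ _ 1 - s)
      (fun v hv => by rcases hs v hv with h | h <;> simp [h]) hx
    simpa using this

/-- In a 2-level polytope, a facet-defining functional can be scaled to have values `0` and `1` at
the vertices. -/
theorem IsTwoLevel.exists_scale {n : ℕ} {P : Set (Fin n → ℝ)} (h2 : IsTwoLevel P)
    (hP : IsPolytope P) (hdim : 1 ≤ dim P) (g : (Fin n → ℝ) →ᵃ[ℝ] ℝ) (hg : ∀ x ∈ P, 0 ≤ g x)
    (hF : IsFacet P {x ∈ P | g x = 0}) :
    ∃ c : ℝ, 0 < c ∧ ∀ v ∈ vert P, c * g v = 0 ∨ c * g v = 1 := by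
  have hdec : ∀ x, g x = g.linear x + g 0 := fun x => by
    have := congrFun g.decomp x
    simpa using this
  obtain ⟨w, hw, hgw⟩ : ∃ w ∈ vert P, g w ≠ 0 := by
    by_contra! hcon
    refine hF.ne (Set.Subset.antisymm (Set.sep_subset _ _) fun x hx => ⟨hx, ?_⟩)
    exact hP.eq_zero g hcon hx
  obtain ⟨p, hp⟩ : {x ∈ P | g x = 0}.Nonempty :=
    nonempty_of_dim_nonneg (by rw [hF.2]; omega)
  have hne : g.linear ≠ 0 := by
    intro h0
    have h1 := hdec p
    have h3 := hdec w
    rw [hp.2, h0] at h1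
    rw [h0] at h3
    simp at h1 h3
    exact hgw (h3.trans h1.symm)
  have hset : {x ∈ P | g.linear x = -g 0} = {x ∈ P | g x = 0} := by
    ext x
    simp only [Set.mem_ofPred_eq, hdec x]
    constructor <;> rintro ⟨a, b⟩ <;> exact ⟨a, by linarith⟩
  obtain ⟨c', hc'⟩ := h2 g.linear (-g 0) hne (fun x hx => by
    have := hg x hx; rw [hdec] at this; linarith) (by rw [hset]; exact hF)
  have key : ∀ v ∈ vert P, g v ≠ 0 → g v = c' + g 0 := by
    intro v hv hv0
    rw [hdec, hc' v hv]
    intro h0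
    exact hv0 (by rw [hdec, h0]; ring)
  have hpos : 0 < g w := lt_of_le_of_ne (hg w (vert_subset hw)) (Ne.symm hgw)
  refine ⟨1 / g w, by positivity, fun v hv => ?_⟩
  by_cases h0 : g v = 0
  · left; simp [h0]
  · right
    rw [key v hv h0, ← key w hw hgw]
    field_simp

theorem setOf_mul_eq_zero {n : ℕ} {P : Set (Fin n → ℝ)} (g : (Fin n → ℝ) →ᵃ[ℝ] ℝ) {c : ℝ}
    (hc : 0 < c) : {x ∈ P | (c • g) x = 0} = {x ∈ P | g x = 0} := by
  ext x
  simp [hc.ne']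

theorem IsFacet.exists_slack {n : ℕ} {P F : Set (Fin n → ℝ)} (hF : IsFacet P F)
    (hP : IsPolytope P) (h2 : IsTwoLevel P) (hdim : 1 ≤ dim P) :
    ∃ s : (Fin n → ℝ) →ᵃ[ℝ] ℝ, IsSlack P F s ∧ F = {x ∈ P | s x = 0} := by
  obtain ⟨g, hg, rfl⟩ := exists_nonneg_of_isExposed hF.1
  obtain ⟨c, hc, hcv⟩ := h2.exists_scale hP hdim g hg hF
  refine ⟨c • g, ⟨fun v hv => by simpa using hcv v hv, fun v hv => ?_⟩,
    (setOf_mul_eq_zero g hc).symm⟩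
  simp [hc.ne', vert_subset hv]

/-- A 2-level polytope is cut out of its affine hull by functionals with values `0` and `1` at the
vertices. -/
theorem IsTwoLevel.exists_neg {n : ℕ} {P : Set (Fin n → ℝ)} (h2 : IsTwoLevel P)
    (hP : IsPolytope P) (hdim : 1 ≤ dim P) {x : Fin n → ℝ} (hx : x ∈ affineSpan ℝ P)
    (hxP : x ∉ P) :
    ∃ s : (Fin n → ℝ) →ᵃ[ℝ] ℝ, (∀ v ∈ vert P, s v = 0 ∨ s v = 1) ∧ s x < 0 := by
  obtain ⟨l, a, hla, hl⟩ := geometric_hahn_banach_point_closed hP.convex hP.isCompact.isClosed hxP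
  obtain ⟨f, hf, -, hfx, hF⟩ := hP.exists_facet
    ((l : (Fin n → ℝ) →ₗ[ℝ] ℝ).toAffineMap - AffineMap.const ℝ _ a)
    (fun v hv => by simpa using (hl v hv).le) hx (by simpa [sub_eq_zero] using hla.ne)
  obtain ⟨c, hc, hcv⟩ := h2.exists_scale hP hdim f hf hF
  refine ⟨c • f, fun v hv => by simpa using hcv v hv, ?_⟩
  have : f x < 0 := by rw [hfx]; simpa using hla
  simpa using mul_neg_of_pos_of_neg hc this

/-- Every proper exposed face of a facet `G` lies in a second facet. If `γ` is the slack functional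
of `G` and `g ≥ 0` exposes the face within `G`, then `g + N γ` is nonnegative on the whole polytope
for large `N`, and the facet is obtained from this functional. -/
theorem IsTwoLevel.exists_extension {n : ℕ} {P G : Set (Fin n → ℝ)} (h2 : IsTwoLevel P)
    (hP : IsPolytope P) (hdim : 1 ≤ dim P) (hG : G ⊆ P) {γ : (Fin n → ℝ) →ᵃ[ℝ] ℝ}
    (hγ : IsSlack P G γ) (hγG : ∀ x ∈ G, γ x = 0)
    (g : (Fin n → ℝ) →ᵃ[ℝ] ℝ) (hg : ∀ x ∈ G, 0 ≤ g x) {u : Fin n → ℝ} (hu : u ∈ G)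
    (hgu : g u ≠ 0) :
    ∃ s : (Fin n → ℝ) →ᵃ[ℝ] ℝ, (∀ v ∈ vert P, s v = 0 ∨ s v = 1) ∧
      IsFacet P {x ∈ P | s x = 0} ∧ (∀ x ∈ G, g x = 0 → s x = 0) ∧ s u ≠ 0 := by
  let N : ℝ := ∑ v ∈ hP.finite_vert.toFinset, |g v|
  have hf : ∀ x, (g + N • γ) x = g x + N * γ x := fun x => by simp
  have hfG : ∀ x ∈ G, (g + N • γ) x = g x := fun x hx => by rw [hf, hγG x hx]; simp
  have hnn : ∀ x ∈ P, 0 ≤ (g + N • γ) x := by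
    intro x hx
    refine hP.nonneg _ (fun v hv => ?_) hx
    rcases hγ.zero_or_one v hv with h0 | h1
    · have hvG := (hγ.eq_zero_iff v hv).1 h0
      rw [hfG v hvG]; exact hg v hvG
    · rw [hf, h1]
      have : |g v| ≤ N := Finset.single_le_sum (f := fun v => |g v|) (fun _ _ => abs_nonneg _)
        (by simpa using hv)
      linarith [neg_abs_le (g v)]
  obtain ⟨f, hf0, hfz, hfu, hF⟩ := hP.exists_facet _ hnn (subset_affineSpan ℝ P (hG hu))
    (by rw [hfG u hu]; exact hgu)
  obtain ⟨c, hc, hcv⟩ := h2.exists_scale hP hdim f hf0 hF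
  refine ⟨c • f, fun v hv => by simpa using hcv v hv, ?_, ?_, ?_⟩
  · rw [setOf_mul_eq_zero f hc]; exact hF
  · intro x hx h0
    have := hfz x (hG hx) (by rw [hfG x hx]; exact h0)
    simp [this]
  · have : f u ≠ 0 := by rw [hfu, hfG u hu]; exact hgu
    simpa using ⟨hc.ne', this⟩

/-- A `0/1` functional that vanishes on a facet, but not everywhere, is its slack functional. -/
theorem IsFacet.isSlack {n : ℕ} {Q F : Set (Fin n → ℝ)} (hF : IsFacet Q F)
    {s : (Fin n → ℝ) →ᵃ[ℝ] ℝ} (hs : ∀ v ∈ vert Q, s v = 0 ∨ s v = 1) (hsF : ∀ x ∈ F, s x = 0)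
    {u : Fin n → ℝ} (hu : u ∈ Q) (hsu : s u ≠ 0) : IsSlack Q F s := by
  obtain ⟨g, hg, hFg⟩ := exists_nonneg_of_isExposed hF.1
  refine ⟨hs, fun v hv => ⟨fun h0 => ?_, fun h => hsF v h⟩⟩
  have := eq_mul_of_dim hF.subset (by rw [hF.2]; omega) s g hsF
    (fun x hx => by rw [hFg] at hx; exact hx.2) hu hsu (vert_subset hv)
  rw [hFg]
  exact ⟨vert_subset hv, by rw [this, h0, mul_zero]⟩

/-! ### Combinatorial isomorphisms -/

theorem IsFacet.eq_of_subset {n : ℕ} {Q F F' : Set (Fin n → ℝ)} (hF : IsFacet Q F)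
    (hF' : IsExposed ℝ Q F') (hsub : F ⊆ F') (hne : F' ≠ F) : F' = Q := by
  obtain ⟨g, hg, hFg⟩ := exists_nonneg_of_isExposed hF.1
  obtain ⟨g', hg', hFg'⟩ := exists_nonneg_of_isExposed hF'
  obtain ⟨u, hu, huF⟩ : ∃ u ∈ F', u ∉ F := by
    by_contra! hcon
    exact hne (Set.Subset.antisymm hcon hsub)
  have hgu : g u ≠ 0 := fun h0 => huF (by rw [hFg]; exact ⟨hF'.subset hu, h0⟩)
  refine Set.Subset.antisymm hF'.subset fun x hx => ?_
  have := eq_mul_of_dim hF.subset (by rw [hF.2]; omega) g g'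
    (fun x hx => by rw [hFg] at hx; exact hx.2)
    (fun x hx => by have := hsub hx; rw [hFg'] at this; exact this.2) (hF'.subset hu) hgu hx
  have hg'u : g' u = 0 := by rw [hFg'] at hu; exact hu.2
  rw [hFg']
  exact ⟨hx, by rw [this, hg'u]; simp⟩

/-- A maximal proper exposed face of a polytope is a facet. -/
theorem isFacet_of_maximal {n : ℕ} {Q F : Set (Fin n → ℝ)} (hQ : IsPolytope Q)
    (hF : IsExposed ℝ Q F) (hne : F ≠ Q)
    (hmax : ∀ F', IsExposed ℝ Q F' → F ⊆ F' → F' ≠ F → F' = Q) : IsFacet Q F := by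
  obtain ⟨g, hg, hFg⟩ := exists_nonneg_of_isExposed hF
  obtain ⟨u, hu, huF⟩ : ∃ u ∈ Q, u ∉ F := by
    by_contra! hcon
    exact hne (Set.Subset.antisymm hF.subset hcon)
  have hgu : g u ≠ 0 := fun h0 => huF (by rw [hFg]; exact ⟨hu, h0⟩)
  obtain ⟨f, -, hfz, -, hf⟩ := hQ.exists_facet g hg (subset_affineSpan ℝ Q hu) hgu
  by_cases h : {x ∈ Q | f x = 0} = F
  · rw [← h]; exact hf
  · refine absurd (hmax _ hf.1 (fun x hx => ?_) h) hf.ne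
    rw [hFg] at hx
    exact ⟨hx.1, hfz x hx.1 hx.2⟩

/-- A minimal nonempty exposed face of a polytope is a vertex. -/
theorem exists_vert_of_minimal {n : ℕ} {Q E : Set (Fin n → ℝ)} (hQ : IsPolytope Q)
    (hE : IsExposed ℝ Q E) (hne : E.Nonempty)
    (hmin : ∀ E', IsExposed ℝ Q E' → E' ⊆ E → E'.Nonempty → E' = E) :
    ∃ w ∈ vert Q, E = {w} := by
  obtain ⟨w, hw⟩ := (isExposed_isPolytope hQ hE).vert_nonempty hne
  have hwQ := vert_subset_of_isExposed hE hw
  exact ⟨w, hwQ, (hmin {w} (hQ.singleton_isExposed hwQ)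
    (Set.singleton_subset_iff.2 (vert_subset hw)) (Set.singleton_nonempty w)).symm⟩

theorem isExposed_empty {n : ℕ} (Q : Set (Fin n → ℝ)) : IsExposed ℝ Q ∅ :=
  fun h => absurd h Set.not_nonempty_empty

/-- Order isomorphisms of face lattices preserve vertices. -/
theorem exists_vert_of_orderIso {m n : ℕ} {P : Set (Fin m → ℝ)} {Q : Set (Fin n → ℝ)}
    (hP : IsPolytope P) (hQ : IsPolytope Q)
    (e : {F : Set (Fin m → ℝ) // IsExposed ℝ P F} ≃o {G : Set (Fin n → ℝ) // IsExposed ℝ Q G})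
    {u : Fin m → ℝ} (hu : u ∈ vert P) :
    ∃ w ∈ vert Q, (e ⟨{u}, hP.singleton_isExposed hu⟩ : Set (Fin n → ℝ)) = {w} := by
  have hemp : ∀ X : {F : Set (Fin m → ℝ) // IsExposed ℝ P F},
      X.1 = ∅ ↔ (e X).1 = ∅ := by
    intro X
    constructor
    · intro h
      have : X ≤ e.symm ⟨∅, isExposed_empty Q⟩ := by
        change X.1 ⊆ _
        rw [h]; exact Set.empty_subset _
      have := e.monotone this
      rw [e.apply_symm_apply] at this
      exact Set.subset_empty_iff.1 this
    · intro h
      have : e X ≤ e ⟨∅, isExposed_empty P⟩ := by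
        change (e X).1 ⊆ _
        rw [h]; exact Set.empty_subset _
      exact Set.subset_empty_iff.1 (e.le_iff_le.1 this)
  refine exists_vert_of_minimal hQ (e _).2 ?_ ?_
  · rw [Set.nonempty_iff_ne_empty]
    intro h
    exact Set.singleton_ne_empty u ((hemp _).2 h)
  · intro E' hE' hsub hne
    have hle : e.symm ⟨E', hE'⟩ ≤ ⟨{u}, hP.singleton_isExposed hu⟩ := by
      rw [← e.le_iff_le, e.apply_symm_apply]
      exact hsub
    have hne' : (e.symm ⟨E', hE'⟩).1 ≠ ∅ := by
      intro h
      rw [hemp, e.apply_symm_apply] at h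
      exact hne.ne_empty h
    have heq : e.symm ⟨E', hE'⟩ = ⟨{u}, hP.singleton_isExposed hu⟩ :=
      Subtype.ext ((Set.subset_singleton_iff_eq.1 hle).resolve_left hne')
    rw [← heq, e.apply_symm_apply]

/-- Order isomorphisms of face lattices preserve facets. -/
theorem isFacet_of_orderIso {m n : ℕ} {P : Set (Fin m → ℝ)} {Q : Set (Fin n → ℝ)}
    (hQ : IsPolytope Q)
    (e : {F : Set (Fin m → ℝ) // IsExposed ℝ P F} ≃o {G : Set (Fin n → ℝ) // IsExposed ℝ Q G})
    {F : Set (Fin m → ℝ)} (hF : IsFacet P F) : IsFacet Q (e ⟨F, hF.1⟩ : Set (Fin n → ℝ)) := by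
  have htop : e ⟨P, IsExposed.refl P⟩ = ⟨Q, IsExposed.refl Q⟩ := by
    apply le_antisymm
    · exact (e _).2.subset
    · rw [← e.symm.le_iff_le, e.symm_apply_apply]
      exact (e.symm _).2.subset
  refine isFacet_of_maximal hQ (e _).2 ?_ ?_
  · intro h
    have : e ⟨F, hF.1⟩ = e ⟨P, IsExposed.refl P⟩ := by rw [htop]; exact Subtype.ext h
    exact hF.ne (congrArg Subtype.val (e.injective this))
  · intro F' hF' hsub hne
    have h1 : (⟨F, hF.1⟩ : {F : Set (Fin m → ℝ) // IsExposed ℝ P F}) ≤ e.symm ⟨F', hF'⟩ := by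
      rw [← e.le_iff_le, e.apply_symm_apply]; exact hsub
    have h2 : (e.symm ⟨F', hF'⟩).1 ≠ F := by
      intro h
      apply hne
      have : e.symm ⟨F', hF'⟩ = ⟨F, hF.1⟩ := Subtype.ext h
      rw [← this, e.apply_symm_apply]
    have h3 : e.symm ⟨F', hF'⟩ = ⟨P, IsExposed.refl P⟩ :=
      Subtype.ext (hF.eq_of_subset (e.symm ⟨F', hF'⟩).2 h1 h2)
    have h4 := congrArg e h3
    rw [e.apply_symm_apply, htop] at h4
    exact congrArg Subtype.val h4

/-- A combinatorial isomorphism induces a map on facets and a surjective map on vertices that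
respect incidence. -/
theorem CombIso.exists_maps {m n : ℕ} {P : Set (Fin m → ℝ)} {Q : Set (Fin n → ℝ)}
    (hP : IsPolytope P) (hQ : IsPolytope Q) (h : CombIso Q P) :
    ∃ (φ : Set (Fin m → ℝ) → Set (Fin n → ℝ)) (β : (Fin m → ℝ) → Fin n → ℝ),
      (∀ F, IsFacet P F → IsFacet Q (φ F)) ∧ (∀ u ∈ vert P, β u ∈ vert Q) ∧
      (∀ w ∈ vert Q, ∃ u ∈ vert P, β u = w) ∧
      ∀ F u, IsFacet P F → u ∈ vert P → (β u ∈ φ F ↔ u ∈ F) := by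
  obtain ⟨e⟩ := h
  classical
  have hv : ∀ u : Fin m → ℝ, ∃ w, ∀ hu : u ∈ vert P, w ∈ vert Q ∧
      (e.symm ⟨{u}, hP.singleton_isExposed hu⟩ : Set (Fin n → ℝ)) = {w} := by
    intro u
    by_cases hu : u ∈ vert P
    · obtain ⟨w, hw, hw'⟩ := exists_vert_of_orderIso hP hQ e.symm hu
      exact ⟨w, fun _ => ⟨hw, hw'⟩⟩
    · exact ⟨0, fun h => absurd h hu⟩
  choose β hβ using hv
  refine ⟨fun F => if hF : IsExposed ℝ P F then (e.symm ⟨F, hF⟩).1 else ∅, β, ?_, ?_, ?_, ?_⟩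
  · intro F hF
    simp only [dif_pos hF.1]
    exact isFacet_of_orderIso hQ e.symm hF
  · exact fun u hu => (hβ u hu).1
  · intro w hw
    obtain ⟨u, hu, hu'⟩ := exists_vert_of_orderIso hQ hP e hw
    refine ⟨u, hu, ?_⟩
    have h1 : e ⟨{w}, hQ.singleton_isExposed hw⟩ = ⟨{u}, hP.singleton_isExposed hu⟩ :=
      Subtype.ext hu'
    have h2 := (hβ u hu).2
    rw [← h1, e.symm_apply_apply] at h2
    exact (Set.singleton_eq_singleton_iff.1 h2).symm
  · intro F u hF hu
    simp only [dif_pos hF.1]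
    rw [← Set.singleton_subset_iff, ← (hβ u hu).2, ← Set.singleton_subset_iff (a := u)]
    exact e.symm.le_iff_le (x := ⟨{u}, hP.singleton_isExposed hu⟩) (y := ⟨F, hF.1⟩)

/-! ### Unit lower triangular matrices and the ground set -/

/-- `M` is lower triangular with ones on the diagonal and all entries in `{0, 1}`. -/
structure IsUnitLower {k : ℕ} (M : Matrix (Fin k) (Fin k) ℝ) : Prop where
  diag : ∀ i, M i i = 1
  upper : ∀ i j, i < j → M i j = 0
  zero_or_one : ∀ i j, M i j = 0 ∨ M i j = 1

theorem det_eq_one_of_lower {R : Type*} [CommRing R] {k : ℕ} {M : Matrix (Fin k) (Fin k) R}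
    (hd : ∀ i, M i i = 1) (hu : ∀ i j, i < j → M i j = 0) : M.det = 1 := by
  rw [Matrix.det_of_isLowerTriangular M fun i j hij => hu i j hij]
  simp [hd]

theorem IsUnitLower.mulVec_injective {k : ℕ} {M : Matrix (Fin k) (Fin k) ℝ} (h : IsUnitLower M) :
    Function.Injective M.mulVec :=
  Matrix.mulVec_injective_of_isUnit ((Matrix.isUnit_iff_isUnit_det M).2 (by
    rw [det_eq_one_of_lower h.diag h.upper]; exact isUnit_one))

/-- The solution of an integral system with a unit lower triangular integral matrix is integral. -/
theorem IsUnitLower.exists_int {k : ℕ} {M : Matrix (Fin k) (Fin k) ℝ} (h : IsUnitLower M)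
    {x : Fin k → ℝ} {y : Fin k → ℤ} (hxy : M *ᵥ x = fun i => (y i : ℝ)) :
    ∃ z : Fin k → ℤ, x = fun i => (z i : ℝ) := by
  have hN : ∀ i j, ∃ a : ℤ, M i j = a := fun i j => by
    rcases h.zero_or_one i j with h0 | h0
    · exact ⟨0, by simp [h0]⟩
    · exact ⟨1, by simp [h0]⟩
  choose N hN using hN
  have hdet : (Matrix.of N).det = 1 := by
    refine det_eq_one_of_lower (fun i => ?_) (fun i j hij => ?_)
    · have := h.diag i; rw [hN] at this; exact_mod_cast this
    · have := h.upper i j hij; rw [hN] at this; exact_mod_cast this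
  refine ⟨(Matrix.of N).adjugate *ᵥ y, h.mulVec_injective ?_⟩
  have h1 : Matrix.of N *ᵥ ((Matrix.of N).adjugate *ᵥ y) = y := by
    rw [Matrix.mulVec_mulVec, Matrix.mul_adjugate, hdet]; simp
  rw [hxy]
  ext i
  have h2 := congrFun h1 i
  rw [← h2]
  simp only [Matrix.mulVec, dotProduct, Matrix.of_apply]
  push_cast
  simp [hN]

theorem extMatrix_mulVec_zero {k : ℕ} (M : Matrix (Fin k) (Fin k) ℝ) (c : Fin k → ℝ)
    (x : Fin (k + 1) → ℝ) : (extMatrix M c *ᵥ x) 0 = x 0 := by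
  simp [extMatrix, Matrix.mulVec, dotProduct, Fin.sum_univ_succ]

theorem extMatrix_mulVec_succ {k : ℕ} (M : Matrix (Fin k) (Fin k) ℝ) (c : Fin k → ℝ)
    (x : Fin (k + 1) → ℝ) (i : Fin k) :
    (extMatrix M c *ᵥ x) i.succ = c i * x 0 + (M *ᵥ fun j => x j.succ) i := by
  simp [extMatrix, Matrix.mulVec, dotProduct, Fin.sum_univ_succ]

theorem IsUnitLower.extMatrix {k : ℕ} {M : Matrix (Fin k) (Fin k) ℝ} (h : IsUnitLower M)
    {c : Fin k → ℝ} (hc : ∀ i, c i = 0 ∨ c i = 1) : IsUnitLower (extMatrix M c) := by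
  constructor
  · intro i
    refine Fin.cases ?_ (fun i => ?_) i
    · simp [TwoLevel.extMatrix]
    · simp [TwoLevel.extMatrix, h.diag]
  · intro i j
    refine Fin.cases ?_ (fun i => ?_) i <;> refine Fin.cases ?_ (fun j => ?_) j <;> intro hij
    · simp at hij
    · simp [TwoLevel.extMatrix]
    · simp at hij
    · simpa [TwoLevel.extMatrix] using h.upper i j (by simpa using hij)
  · intro i j
    refine Fin.cases ?_ (fun i => ?_) i <;> refine Fin.cases ?_ (fun j => ?_) j
    · simp [TwoLevel.extMatrix]
    · simp [TwoLevel.extMatrix]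
    · simpa [TwoLevel.extMatrix] using hc i
    · simpa [TwoLevel.extMatrix] using h.zero_or_one i j

theorem IsUnitLower.mem_Xfull {k : ℕ} {M : Matrix (Fin k) (Fin k) ℝ} (h : IsUnitLower M)
    {x : Fin (k + 1) → ℝ} :
    x ∈ Xfull M ↔ ∃ c y : Fin k → ℝ, (∀ i, c i = 0 ∨ c i = 1) ∧ (∀ i, y i = 0 ∨ y i = 1) ∧
      TwoLevel.extMatrix M c *ᵥ x = (Fin.cons 1 y : Fin (k + 1) → ℝ) := by
  refine exists_congr fun c => exists_congr fun y => and_congr_right fun hc =>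
    and_congr_right fun hy => ?_
  have hE := h.extMatrix hc
  have hdet : IsUnit (TwoLevel.extMatrix M c).det := by
    rw [det_eq_one_of_lower hE.diag hE.upper]; exact isUnit_one
  constructor
  · rintro rfl
    rw [Matrix.mulVec_mulVec, Matrix.mul_nonsing_inv _ hdet, Matrix.one_mulVec]
  · intro hx
    rw [← hx, Matrix.mulVec_mulVec, Matrix.nonsing_inv_mul _ hdet, Matrix.one_mulVec]

theorem IsUnitLower.apply_zero_of_mem_Xfull {k : ℕ} {M : Matrix (Fin k) (Fin k) ℝ}
    (h : IsUnitLower M) {x : Fin (k + 1) → ℝ} (hx : x ∈ Xfull M) : x 0 = 1 := by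
  obtain ⟨c, y, -, -, hxy⟩ := h.mem_Xfull.1 hx
  rw [← extMatrix_mulVec_zero M c x, hxy, Fin.cons_zero]

theorem IsUnitLower.int_of_mem_Xfull {k : ℕ} {M : Matrix (Fin k) (Fin k) ℝ}
    (h : IsUnitLower M) {x : Fin (k + 1) → ℝ} (hx : x ∈ Xfull M) :
    ∃ z : Fin (k + 1) → ℤ, x = fun i => (z i : ℝ) := by
  obtain ⟨c, y, hc, hy, hxy⟩ := h.mem_Xfull.1 hx
  have hy' : ∀ i, ∃ a : ℤ, y i = a := fun i => by
    rcases hy i with h0 | h0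
    · exact ⟨0, by simp [h0]⟩
    · exact ⟨1, by simp [h0]⟩
  choose b hb using hy'
  refine (h.extMatrix hc).exists_int (y := Fin.cons 1 b) ?_
  rw [hxy]
  ext i
  refine Fin.cases ?_ (fun i => ?_) i <;> simp [hb]

theorem IsUnitLower.e₁_mem_Xfull {k : ℕ} {M : Matrix (Fin k) (Fin k) ℝ} (h : IsUnitLower M) :
    e₁ ∈ Xfull M := by
  refine h.mem_Xfull.2 ⟨0, 0, by simp, by simp, ?_⟩
  ext i
  refine Fin.cases ?_ (fun i => ?_) i
  · rw [extMatrix_mulVec_zero]; simp [e₁]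
  · rw [extMatrix_mulVec_succ]; simp [e₁, Matrix.mulVec, dotProduct]

/-! ### Simplicial cores -/

/-- The linear part of `coreChart v`. -/
noncomputable def coreLinear {d n : ℕ} (v : Fin (d + 1) → Fin n → ℝ) :
    (Fin d → ℝ) →ₗ[ℝ] (Fin n → ℝ) :=
  Fintype.linearCombination ℝ fun j : Fin d => v j.castSucc - v (Fin.last d)

/-- `coreChart v` as an affine map. -/
noncomputable def coreAffine {d n : ℕ} (v : Fin (d + 1) → Fin n → ℝ) :
    (Fin d → ℝ) →ᵃ[ℝ] (Fin n → ℝ) :=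
  AffineMap.const ℝ _ (v (Fin.last d)) + (coreLinear v).toAffineMap

theorem coreChart_eq {d n : ℕ} (v : Fin (d + 1) → Fin n → ℝ) (x : Fin d → ℝ) :
    coreChart v x = v (Fin.last d) + coreLinear v x := by
  simp [coreChart, coreLinear, Fintype.linearCombination_apply]

theorem coreAffine_apply {d n : ℕ} (v : Fin (d + 1) → Fin n → ℝ) (x : Fin d → ℝ) :
    coreAffine v x = coreChart v x := by
  simp [coreAffine, coreChart_eq]

theorem apply_coreChart {d n : ℕ} (v : Fin (d + 1) → Fin n → ℝ) (s : (Fin n → ℝ) →ᵃ[ℝ] ℝ)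
    (x : Fin d → ℝ) : s (coreChart v x) =
      s (v (Fin.last d)) + ∑ j : Fin d, x j * (s (v j.castSucc) - s (v (Fin.last d))) := by
  have h1 : ∀ j : Fin d, s.linear (v j.castSucc - v (Fin.last d)) =
      s (v j.castSucc) - s (v (Fin.last d)) := fun j => by
    have := s.linearMap_vsub (v j.castSucc) (v (Fin.last d))
    simpa using this
  have h2 : coreChart v x
      = (∑ j : Fin d, x j • (v j.castSucc - v (Fin.last d))) +ᵥ v (Fin.last d) := by
    simp [coreChart, add_comm]
  rw [h2, s.map_vadd, map_sum]
  simp [h1, add_comm]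

theorem coreChart_single {d n : ℕ} (v : Fin (d + 1) → Fin n → ℝ) (j : Fin d) :
    coreChart v (Pi.single j 1) = v j.castSucc := by
  rw [coreChart, Finset.sum_eq_single j]
  · simp
  · intro i _ hi; simp [hi]
  · simp

theorem coreChart_e₁ {k n : ℕ} (v : Fin (k + 1 + 1) → Fin n → ℝ) : coreChart v e₁ = v 0 := by
  rw [e₁, coreChart_single]; rfl

theorem coreChart_zero {d n : ℕ} (v : Fin (d + 1) → Fin n → ℝ) :
    coreChart v 0 = v (Fin.last d) := by
  simp [coreChart]

theorem IsSimplicialCore.isUnitLower {d n : ℕ} {P : Set (Fin n → ℝ)}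
    {F : Fin (d + 1) → Set (Fin n → ℝ)} {v : Fin (d + 1) → Fin n → ℝ}
    (h : IsSimplicialCore P F v) : IsUnitLower (coreMatrix F v) := by
  classical
  constructor
  · intro i; simp [coreMatrix, h.notMem]
  · intro i j hij
    simp [coreMatrix, h.mem i.castSucc j.castSucc (by simpa using hij)]
  · intro i j
    by_cases hij : v j.castSucc ∈ F i.castSucc <;> simp [coreMatrix, hij]

/-- The embedding transformation matrix maps the coordinates of a point to its slacks with respect
to the core facets. -/
theorem IsSimplicialCore.slack_coreChart {d n : ℕ} {P : Set (Fin n → ℝ)}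
    {F : Fin (d + 1) → Set (Fin n → ℝ)} {v : Fin (d + 1) → Fin n → ℝ}
    (h : IsSimplicialCore P F v) {s : Fin d → (Fin n → ℝ) →ᵃ[ℝ] ℝ}
    (hs : ∀ i, IsSlack P (F i.castSucc) (s i)) (x : Fin d → ℝ) (i : Fin d) :
    s i (coreChart v x) = (coreMatrix F v *ᵥ x) i := by
  classical
  have h0 : s i (v (Fin.last d)) = 0 :=
    ((hs i).eq_zero_iff _ (h.vertex _)).2 (h.mem _ _ (Fin.castSucc_lt_last i))
  rw [apply_coreChart, h0, zero_add]
  refine Finset.sum_congr rfl fun j _ => ?_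
  rw [mul_comm, sub_zero]
  congr 1
  by_cases hij : v j.castSucc ∈ F i.castSucc
  · rw [((hs i).eq_zero_iff _ (h.vertex _)).2 hij]
    simp [coreMatrix, hij]
  · have h1 := ((hs i).zero_or_one _ (h.vertex j.castSucc)).resolve_left
      (fun h0 => hij (((hs i).eq_zero_iff _ (h.vertex _)).1 h0))
    rw [h1]
    simp [coreMatrix, hij]

theorem IsSimplicialCore.coreChart_injective {d n : ℕ} {P : Set (Fin n → ℝ)}
    {F : Fin (d + 1) → Set (Fin n → ℝ)} {v : Fin (d + 1) → Fin n → ℝ}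
    (h : IsSimplicialCore P F v) {s : Fin d → (Fin n → ℝ) →ᵃ[ℝ] ℝ}
    (hs : ∀ i, IsSlack P (F i.castSucc) (s i)) : Function.Injective (coreChart v) := by
  intro x y hxy
  refine h.isUnitLower.mulVec_injective (funext fun i => ?_)
  rw [← h.slack_coreChart hs, ← h.slack_coreChart hs, hxy]

/-- The vertices of a simplicial core affinely span the polytope. -/
theorem IsSimplicialCore.exists_coreChart {d n : ℕ} {P : Set (Fin n → ℝ)}
    {F : Fin (d + 1) → Set (Fin n → ℝ)} {v : Fin (d + 1) → Fin n → ℝ}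
    (h : IsSimplicialCore P F v) {s : Fin d → (Fin n → ℝ) →ᵃ[ℝ] ℝ}
    (hs : ∀ i, IsSlack P (F i.castSucc) (s i)) (hdim : dim P = d) {u : Fin n → ℝ} (hu : u ∈ P) :
    ∃ x, coreChart v x = u := by
  have hinj : Function.Injective (coreLinear v) := by
    intro x y hxy
    apply h.coreChart_injective hs
    rw [coreChart_eq, coreChart_eq, hxy]
  have hle : LinearMap.range (coreLinear v) ≤ vectorSpan ℝ P := by
    rintro _ ⟨x, rfl⟩
    rw [coreLinear, Fintype.linearCombination_apply]
    exact Submodule.sum_mem _ fun j _ => Submodule.smul_mem _ _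
      (vsub_mem_vectorSpan ℝ (vert_subset (h.vertex _)) (vert_subset (h.vertex _)))
  have heq : LinearMap.range (coreLinear v) = vectorSpan ℝ P := by
    refine Submodule.eq_of_le_of_finrank_le hle ?_
    rw [LinearMap.finrank_range_of_inj hinj]
    rw [dim_of_nonempty ⟨u, hu⟩] at hdim
    simp
    omega
  have hmem : u -ᵥ v (Fin.last d) ∈ LinearMap.range (coreLinear v) := by
    rw [heq]
    exact vsub_mem_vectorSpan ℝ hu (vert_subset (h.vertex _))
  obtain ⟨x, hx⟩ := hmem
  exact ⟨x, by rw [coreChart_eq, hx]; simp⟩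

theorem coreChart_mem_affineSpan {d n : ℕ} {P : Set (Fin n → ℝ)} {v : Fin (d + 1) → Fin n → ℝ}
    (hv : ∀ i, v i ∈ P) (x : Fin d → ℝ) : coreChart v x ∈ affineSpan ℝ P := by
  have : coreChart v x = coreLinear v x +ᵥ v (Fin.last d) := by
    rw [coreChart_eq, add_comm]; rfl
  rw [this]
  refine AffineSubspace.vadd_mem_of_mem_direction ?_ (mem_affineSpan ℝ (hv _))
  rw [direction_affineSpan, coreLinear, Fintype.linearCombination_apply]
  exact Submodule.sum_mem _ fun j _ => Submodule.smul_mem _ _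
      (vsub_mem_vectorSpan ℝ (hv _) (hv _))

theorem hEmbedding_eq_convexHull {d n : ℕ} {P : Set (Fin n → ℝ)} (hP : IsPolytope P)
    {v : Fin (d + 1) → Fin n → ℝ} (hinj : Function.Injective (coreChart v))
    (hsurj : ∀ u ∈ P, ∃ x, coreChart v x = u) :
    hEmbedding P v = convexHull ℝ {x | coreChart v x ∈ vert P} := by
  have himg : coreAffine v '' {x | coreChart v x ∈ vert P} = vert P := by
    ext u
    constructor
    · rintro ⟨x, hx, rfl⟩
      rw [coreAffine_apply]; exact hx
    · intro hu
      obtain ⟨x, rfl⟩ := hsurj u (vert_subset hu)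
      exact ⟨x, hu, coreAffine_apply v x⟩
  have h1 := (coreAffine v).image_convexHull {x | coreChart v x ∈ vert P}
  rw [himg, hP.convexHull_vert] at h1
  ext x
  change coreChart v x ∈ P ↔ _
  constructor
  · intro hx
    rw [← h1] at hx
    obtain ⟨y, hy, hyx⟩ := hx
    rw [coreAffine_apply] at hyx
    rwa [← hinj hyx]
  · intro hx
    rw [← coreAffine_apply]
    exact h1.subset ⟨x, hx, rfl⟩

/-- The `ℋ`-embedding is determined by the incidences between vertices and core facets. -/
theorem setOf_coreChart_mem_vert_eq {k m n : ℕ} {P : Set (Fin m → ℝ)} {Q : Set (Fin n → ℝ)}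
    {F : Fin (k + 1) → Set (Fin m → ℝ)} {v : Fin (k + 1) → Fin m → ℝ}
    {F' : Fin (k + 1) → Set (Fin n → ℝ)} {w : Fin (k + 1) → Fin n → ℝ}
    (hF : IsSimplicialCore P F v) (hF' : IsSimplicialCore Q F' w)
    {s : Fin k → (Fin m → ℝ) →ᵃ[ℝ] ℝ} (hs : ∀ i, IsSlack P (F i.castSucc) (s i))
    {t : Fin k → (Fin n → ℝ) →ᵃ[ℝ] ℝ} (ht : ∀ i, IsSlack Q (F' i.castSucc) (t i))
    (hP : dim P = k) (hQ : dim Q = k) (hM : coreMatrix F v = coreMatrix F' w)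
    (β : (Fin m → ℝ) → Fin n → ℝ) (hβ : ∀ u ∈ vert P, β u ∈ vert Q)
    (hβ' : ∀ y ∈ vert Q, ∃ u ∈ vert P, β u = y)
    (hinc : ∀ i u, u ∈ vert P → (β u ∈ F' i ↔ u ∈ F i)) :
    {x | coreChart v x ∈ vert P} = {x | coreChart w x ∈ vert Q} := by
  have key : ∀ x x', coreChart v x ∈ vert P → coreChart w x' = β (coreChart v x) → x = x' := by
    intro x x' hx hx'
    refine hF.isUnitLower.mulVec_injective (funext fun i => ?_)
    rw [← hF.slack_coreChart hs, hM, ← hF'.slack_coreChart ht, hx']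
    have h1 := (hs i).eq_zero_iff _ hx
    have h2 := (ht i).eq_zero_iff _ (hβ _ hx)
    rw [hinc _ _ hx, ← h1] at h2
    rcases (hs i).zero_or_one _ hx with h3 | h3 <;>
      rcases (ht i).zero_or_one _ (hβ _ hx) with h4 | h4
    · rw [h3, h4]
    · rw [h3, h4] at h2; norm_num at h2
    · rw [h3, h4] at h2; norm_num at h2
    · rw [h3, h4]
  ext x
  constructor
  · intro hx
    obtain ⟨x', hx'⟩ := hF'.exists_coreChart ht hQ (vert_subset (hβ _ hx))
    have := key x x' hx hx'
    subst this
    change coreChart w x ∈ vert Q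
    rw [hx']
    exact hβ _ hx
  · intro hx
    obtain ⟨u, hu, hu'⟩ := hβ' _ hx
    obtain ⟨x', rfl⟩ := hF.exists_coreChart hs hP (vert_subset hu)
    have := key x' x hu hu'.symm
    subst this
    exact hu

/-- In coordinates, a functional with values `0` and `1` at the core vertices is `x(E)` or
`1 - x(E)`. -/
theorem exists_edge {d n : ℕ} {v : Fin (d + 1) → Fin n → ℝ} {s : (Fin n → ℝ) →ᵃ[ℝ] ℝ}
    (hs : ∀ i, s (v i) = 0 ∨ s (v i) = 1) :
    ∃ E : Finset (Fin d), (∀ x, s (coreChart v x) = ∑ i ∈ E, x i) ∨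
      (∀ x, s (coreChart v x) = 1 - ∑ i ∈ E, x i) := by
  classical
  refine ⟨Finset.univ.filter fun j => s (v j.castSucc) ≠ s (v (Fin.last d)), ?_⟩
  rcases hs (Fin.last d) with h0 | h1
  · left
    intro x
    rw [apply_coreChart, h0, zero_add, Finset.sum_filter]
    refine Finset.sum_congr rfl fun j _ => ?_
    rcases hs j.castSucc with h | h <;> simp [h]
  · right
    intro x
    rw [apply_coreChart, h1, sub_eq_add_neg, Finset.sum_filter, ← Finset.sum_neg_distrib]
    congr 1
    refine Finset.sum_congr rfl fun j _ => ?_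
    rcases hs j.castSucc with h | h <;> simp [h]

/-! ### Extending the core of the base -/

/-- `(F; v)` is a simplicial core of `P` whose first facet is placed as `B` in `{x | x 0 = 0}` by
the `ℋ`-embedding, and whose embedding matrix is `extMatrix M c`. The functionals `s i` are the
slacks of the core facets, and the first core vertex is lexicographically minimal, with respect to
these slacks, among the vertices that are not on the first facet. -/
structure IsCoreExtension {k n : ℕ} (M : Matrix (Fin k) (Fin k) ℝ) (c : Fin k → ℝ)
    (B : Set (Fin (k + 1) → ℝ)) (P : Set (Fin n → ℝ)) (F : Fin (k + 1 + 1) → Set (Fin n → ℝ))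
    (v : Fin (k + 1 + 1) → Fin n → ℝ) (s : Fin (k + 1) → (Fin n → ℝ) →ᵃ[ℝ] ℝ) : Prop where
  core : IsSimplicialCore P F v
  slack : ∀ i, IsSlack P (F i.castSucc) (s i)
  matrix : coreMatrix F v = extMatrix M c
  zero_or_one : ∀ i, c i = 0 ∨ c i = 1
  base_eq : B = {x ∈ hEmbedding P v | x 0 = 0}
  base_polytope : IsPolytope B
  vert_base : ∀ x ∈ vert B, coreChart v x ∈ vert P
  lex : ∀ u ∈ vert P, s 0 u = 1 → toLex (fun i => s i (v 0)) ≤ toLex (fun i => s i u)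

theorem coreChart_cons_zero {k n : ℕ} (u : Fin n → ℝ) (w : Fin (k + 1) → Fin n → ℝ)
    (x : Fin k → ℝ) :
    coreChart (Fin.cons u w : Fin (k + 1 + 1) → Fin n → ℝ) (Fin.cons 0 x : Fin (k + 1) → ℝ) =
      coreChart w x := by
  have hlast : (Fin.cons u w : Fin (k + 1 + 1) → Fin n → ℝ) (Fin.last (k + 1)) =
      w (Fin.last k) := by
    rw [← Fin.succ_last, Fin.cons_succ]
  simp only [coreChart, hlast, Fin.sum_univ_succ, Fin.cons_zero, zero_smul, zero_add,
    Fin.cons_succ, ← Fin.succ_castSucc]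

theorem base_eq_convexHull {k m : ℕ} {P₀ : Set (Fin m → ℝ)} {v : Fin (k + 1) → Fin m → ℝ}
    {S : Set (Fin k → ℝ)} (h : hEmbedding P₀ v = convexHull ℝ S) :
    base P₀ v = convexHull ℝ ((fun x : Fin k → ℝ => (Fin.cons 0 x : Fin (k + 1) → ℝ)) '' S) := by
  have hlin : IsLinearMap ℝ (fun x : Fin k → ℝ => (Fin.cons 0 x : Fin (k + 1) → ℝ)) := by
    constructor
    · intro x y; ext i; refine Fin.cases ?_ (fun i => ?_) i <;> simp
    · intro a x; ext i; refine Fin.cases ?_ (fun i => ?_) i <;> simp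
  rw [base, h, hlin.image_convexHull]

/-- A 2-level polytope with a facet isomorphic to `P₀` has a simplicial core that extends the given
core of `P₀`. -/
theorem exists_isCoreExtension {k m n : ℕ} {P₀ : Set (Fin m → ℝ)}
    {F : Fin (k + 1) → Set (Fin m → ℝ)} {v : Fin (k + 1) → Fin m → ℝ}
    (hP₀ : IsPolytope P₀) (hdim₀ : dim P₀ = (k : ℤ)) (h2₀ : IsTwoLevel P₀)
    (hΓ : IsSimplicialCore P₀ F v) {P G : Set (Fin n → ℝ)} (hP : IsPolytope P)
    (hdim : dim P = (k : ℤ) + 1) (h2 : IsTwoLevel P) (hG : IsFacet P G) (hiso : CombIso G P₀) :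
    ∃ (c : Fin k → ℝ) (F' : Fin (k + 1 + 1) → Set (Fin n → ℝ))
      (v' : Fin (k + 1 + 1) → Fin n → ℝ) (s : Fin (k + 1) → (Fin n → ℝ) →ᵃ[ℝ] ℝ),
      IsCoreExtension (coreMatrix F v) c (base P₀ v) P F' v' s := by
  classical
  have hdim1 : 1 ≤ dim P := by omega
  have hGp : IsPolytope G := isExposed_isPolytope hP hG.1
  have hGdim : dim G = (k : ℤ) := by rw [hG.2, hdim]; omega
  obtain ⟨γ, hγ, hGγ⟩ := hG.exists_slack hP h2 hdim1
  have hγG : ∀ x ∈ G, γ x = 0 := fun x hx => by rw [hGγ] at hx; exact hx.2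
  have hGP : vert G ⊆ vert P := vert_subset_of_isExposed hG.1
  -- the core of `P₀`, transported to `G`
  obtain ⟨φ, β, hφ, hβ, hβ', hinc⟩ := hiso.exists_maps hP₀ hGp
  let w : Fin (k + 1) → Fin n → ℝ := fun i => β (v i)
  have hw : ∀ i, w i ∈ vert G := fun i => hβ _ (hΓ.vertex i)
  have hwG : ∀ i, w i ∈ G := fun i => vert_subset (hw i)
  have hcoreG : IsSimplicialCore G (fun i => φ (F i)) w :=
    ⟨fun i => hφ _ (hΓ.facet i), hw,
      fun i => by rw [hinc _ _ (hΓ.facet i) (hΓ.vertex i)]; exact hΓ.notMem i,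
      fun i j hij => by rw [hinc _ _ (hΓ.facet i) (hΓ.vertex j)]; exact hΓ.mem i j hij⟩
  -- each core facet of `G` lies in a second facet of `P`
  have ht : ∀ i, ∃ t : (Fin n → ℝ) →ᵃ[ℝ] ℝ, (∀ u ∈ vert P, t u = 0 ∨ t u = 1) ∧
      IsFacet P {x ∈ P | t x = 0} ∧ (∀ x ∈ φ (F i), t x = 0) ∧ t (w i) ≠ 0 := by
    intro i
    obtain ⟨g, hg, hFg⟩ := exists_nonneg_of_isExposed (hcoreG.facet i).1
    have hFg' : φ (F i) = {x ∈ G | g x = 0} := hFg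
    have hgw : g (w i) ≠ 0 := fun h0 => hcoreG.notMem i (by
      rw [hFg']; exact ⟨hwG i, h0⟩)
    obtain ⟨t, h1, h3, h4, h5⟩ :=
      h2.exists_extension hP hdim1 hG.subset hγ hγG g hg (hwG i) hgw
    refine ⟨t, h1, h3, fun x hx => ?_, h5⟩
    rw [hFg'] at hx
    exact h4 x hx.1 hx.2
  choose t ht1 htF htφ htw using ht
  have htG : ∀ i, IsSlack G (φ (F i)) (t i) := fun i =>
    (hcoreG.facet i).isSlack (fun u hu => ht1 i u (hGP hu)) (htφ i) (hwG i) (htw i)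
  let s : Fin (k + 1) → (Fin n → ℝ) →ᵃ[ℝ] ℝ := Fin.cons γ fun i : Fin k => t i.castSucc
  -- the lexicographically minimal vertex off `G`
  obtain ⟨v₁, ⟨hv₁, hv₁G⟩, hmin⟩ : ∃ v₁ ∈ {u | u ∈ vert P ∧ u ∉ G},
      ∀ u ∈ {u | u ∈ vert P ∧ u ∉ G}, toLex (fun i => s i v₁) ≤ toLex (fun i => s i u) := by
    refine Set.exists_min_image _ _ (hP.finite_vert.subset fun u hu => hu.1) ?_
    by_contra hcon
    rw [Set.not_nonempty_iff_eq_empty] at hcon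
    refine hG.ne (Set.Subset.antisymm hG.subset ?_)
    rw [← hP.convexHull_vert]
    refine convexHull_min (fun u hu => ?_) hGp.convex
    by_contra huG
    exact hcon.subset ⟨hu, huG⟩
  let F' : Fin (k + 1 + 1) → Set (Fin n → ℝ) := Fin.cons G fun i => {x ∈ P | t i x = 0}
  let v' : Fin (k + 1 + 1) → Fin n → ℝ := Fin.cons v₁ w
  have hcore : IsSimplicialCore P F' v' := by
    constructor
    · intro i
      refine Fin.cases hG (fun i => htF i) i
    · intro i
      refine Fin.cases hv₁ (fun i => hGP (hw i)) i
    · intro i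
      refine Fin.cases hv₁G (fun i => ?_) i
      exact fun h => htw i h.2
    · intro i j
      refine Fin.cases ?_ (fun j => ?_) j
      · intro h; simp at h
      · refine Fin.cases (fun _ => hwG j) (fun i hij => ?_) i
        exact ⟨hG.subset (hwG j), htφ i _ (hcoreG.mem i j (by simpa using hij))⟩
  have hslack : ∀ i, IsSlack P (F' i.castSucc) (s i) := by
    intro i
    refine Fin.cases hγ (fun i => ?_) i
    rw [← Fin.succ_castSucc]
    exact ⟨ht1 _, fun u hu => ⟨fun h => ⟨vert_subset hu, h⟩, fun h => h.2⟩⟩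
  have hM : coreMatrix F v = coreMatrix (fun i => φ (F i)) w := by
    ext i j
    simp only [coreMatrix, Matrix.of_apply, w, hinc _ _ (hΓ.facet i.castSucc) (hΓ.vertex _)]
  have hmatrix : coreMatrix F' v' =
      extMatrix (coreMatrix F v) fun i => coreMatrix F' v' i.succ 0 := by
    ext i j
    refine Fin.cases ?_ (fun i => ?_) i <;> refine Fin.cases ?_ (fun j => ?_) j
    · simp [coreMatrix, extMatrix, F', v', hv₁G]
    · simp [coreMatrix, extMatrix, F', v', hwG]
    · simp [extMatrix]
    · rw [hM]
      simp only [coreMatrix, extMatrix, F', v', Matrix.of_apply, ← Fin.succ_castSucc,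
        Fin.cons_succ]
      congr 1
      apply propext
      rw [← (htG i.castSucc).eq_zero_iff _ (hw _)]
      exact ⟨fun h => h.2, fun h => ⟨hG.subset (hwG _), h⟩⟩
  -- the coordinates of the vertices of `P₀` and of `G` agree
  have hs₀ : ∀ i : Fin k, ∃ s₀ : (Fin m → ℝ) →ᵃ[ℝ] ℝ, IsSlack P₀ (F i.castSucc) s₀ := by
    intro i
    have : 1 ≤ dim P₀ := by rw [hdim₀]; have := i.pos; omega
    obtain ⟨s₀, hs₀, -⟩ := (hΓ.facet i.castSucc).exists_slack hP₀ h2₀ this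
    exact ⟨s₀, hs₀⟩
  choose s₀ hs₀ using hs₀
  have htG' : ∀ i : Fin k, IsSlack G ((fun i => φ (F i)) i.castSucc) (t i.castSucc) :=
    fun i => htG _
  have hcoord := setOf_coreChart_mem_vert_eq hΓ hcoreG hs₀ htG' hdim₀ hGdim hM β hβ hβ'
    fun i u hu => hinc _ _ (hΓ.facet i) hu
  have hemb₀ := hEmbedding_eq_convexHull hP₀ (hΓ.coreChart_injective hs₀)
    fun u hu => hΓ.exists_coreChart hs₀ hdim₀ hu
  have hembG := hEmbedding_eq_convexHull hGp (hcoreG.coreChart_injective htG')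
    fun u hu => hcoreG.exists_coreChart htG' hGdim hu
  have hemb : hEmbedding P₀ v = hEmbedding G w := by rw [hemb₀, hcoord, hembG]
  have hbase := base_eq_convexHull (hemb₀.trans (congrArg _ hcoord))
  have hfin : {x | coreChart w x ∈ vert G}.Finite :=
    hGp.finite_vert.preimage (hcoreG.coreChart_injective htG').injOn
  refine ⟨fun i => coreMatrix F' v' i.succ 0, F', v', s, hcore, hslack, hmatrix,
    fun i => hcore.isUnitLower.zero_or_one _ _, ?_, ?_, ?_, ?_⟩
  · ext x
    rw [base, hemb]
    constructor
    · rintro ⟨y, hy, rfl⟩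
      refine ⟨?_, rfl⟩
      change coreChart (Fin.cons v₁ w : Fin (k + 1 + 1) → Fin n → ℝ) _ ∈ P
      rw [coreChart_cons_zero]
      exact hG.subset hy
    · rintro ⟨hx, hx0⟩
      have hxc : (Fin.cons 0 (Fin.tail x) : Fin (k + 1) → ℝ) = x := by
        rw [← hx0, Fin.cons_self_tail]
      refine ⟨Fin.tail x, ?_, hxc⟩
      change coreChart (Fin.cons v₁ w : Fin (k + 1 + 1) → Fin n → ℝ) x ∈ P at hx
      rw [← hxc, coreChart_cons_zero] at hx
      change coreChart w (Fin.tail x) ∈ G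
      rw [hGγ]
      refine ⟨hx, ?_⟩
      rw [apply_coreChart]
      simp [hγG _ (hwG _)]
  · refine ⟨(hfin.image fun x => (Fin.cons 0 x : Fin (k + 1) → ℝ)).toFinset, ?_⟩
    rw [hbase, Set.Finite.coe_toFinset]
  · intro x hx
    rw [hbase] at hx
    obtain ⟨y, hy, rfl⟩ := extremePoints_convexHull_subset hx
    change coreChart (Fin.cons v₁ w : Fin (k + 1 + 1) → Fin n → ℝ) _ ∈ _
    rw [coreChart_cons_zero]
    exact hGP hy
  · intro u hu hu1
    refine hmin u ⟨hu, fun huG => ?_⟩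
    have : γ u = 1 := hu1
    rw [hγG u huG] at this
    norm_num at this

/-! ### The vertices off the base form a closed subset of the reduced ground set -/

/-- The coordinates of the vertices of `P` that lie off the base facet. -/
def upperVert {k n : ℕ} (P : Set (Fin n → ℝ)) (v : Fin (k + 1 + 1) → Fin n → ℝ) :
    Set (Fin (k + 1) → ℝ) :=
  {x | coreChart v x ∈ vert P ∧ x 0 = 1}

section

variable {k n : ℕ} {M : Matrix (Fin k) (Fin k) ℝ} {c : Fin k → ℝ} {B : Set (Fin (k + 1) → ℝ)}
  {P : Set (Fin n → ℝ)} {F : Fin (k + 1 + 1) → Set (Fin n → ℝ)}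
  {v : Fin (k + 1 + 1) → Fin n → ℝ} {s : Fin (k + 1) → (Fin n → ℝ) →ᵃ[ℝ] ℝ}

theorem IsCoreExtension.slack_coreChart (h : IsCoreExtension M c B P F v s)
    (x : Fin (k + 1) → ℝ) (i : Fin (k + 1)) :
    s i (coreChart v x) = (extMatrix M c *ᵥ x) i := by
  rw [h.core.slack_coreChart h.slack, h.matrix]

theorem IsCoreExtension.slack_zero (h : IsCoreExtension M c B P F v s)
    (x : Fin (k + 1) → ℝ) : s 0 (coreChart v x) = x 0 := by
  rw [h.slack_coreChart, extMatrix_mulVec_zero]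

theorem IsCoreExtension.isUnitLower (h : IsCoreExtension M c B P F v s) :
    IsUnitLower (extMatrix M c) := h.matrix ▸ h.core.isUnitLower

theorem IsCoreExtension.injective (h : IsCoreExtension M c B P F v s) :
    Function.Injective (coreChart v) := h.core.coreChart_injective h.slack

theorem IsCoreExtension.exists_coreChart (h : IsCoreExtension M c B P F v s)
    (hdim : dim P = (k : ℤ) + 1) {u : Fin n → ℝ} (hu : u ∈ P) : ∃ x, coreChart v x = u :=
  h.core.exists_coreChart h.slack (by push_cast; exact hdim) hu

theorem IsCoreExtension.hEmbedding_eq (h : IsCoreExtension M c B P F v s) (hP : IsPolytope P)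
    (hdim : dim P = (k : ℤ) + 1) :
    hEmbedding P v = convexHull ℝ (vert B ∪ upperVert P v) := by
  have heq := hEmbedding_eq_convexHull hP h.injective fun u hu => h.exists_coreChart hdim hu
  apply Set.Subset.antisymm
  · rw [heq]
    refine convexHull_min (fun x hx => ?_) (convex_convexHull ℝ _)
    have hx' : coreChart v x ∈ vert P := hx
    rcases (h.slack 0).zero_or_one _ hx' with h0 | h1
    · rw [h.slack_zero] at h0
      have hxB : x ∈ B := by
        rw [h.base_eq]
        exact ⟨(vert_subset hx' : coreChart v x ∈ P), h0⟩
      rw [← h.base_polytope.convexHull_vert] at hxB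
      exact convexHull_mono Set.subset_union_left hxB
    · rw [h.slack_zero] at h1
      exact subset_convexHull ℝ _ (Or.inr ⟨hx, h1⟩)
  · refine convexHull_min (Set.union_subset (fun x hx => ?_) fun x hx => ?_) ?_
    · exact (vert_subset (h.vert_base x hx) : coreChart v x ∈ P)
    · exact (vert_subset hx.1 : coreChart v x ∈ P)
    · rw [heq]; exact convex_convexHull ℝ _

theorem IsCoreExtension.coreChart_mem_vert (h : IsCoreExtension M c B P F v s)
    {x : Fin (k + 1) → ℝ} (hx : x ∈ vert B ∪ upperVert P v) : coreChart v x ∈ vert P := by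
  rcases hx with hx | hx
  · exact h.vert_base x hx
  · exact hx.1

theorem IsCoreExtension.upperVert_subset_Xfull (h : IsCoreExtension M c B P F v s)
    (hM : IsUnitLower M) : upperVert P v ⊆ Xfull M := by
  rintro x ⟨hx, hx0⟩
  refine hM.mem_Xfull.2 ⟨c, fun i => (extMatrix M c *ᵥ x) i.succ, h.zero_or_one, fun i => ?_, ?_⟩
  · simp only [← h.slack_coreChart]
    exact (h.slack _).zero_or_one _ hx
  · ext i
    refine Fin.cases ?_ (fun i => ?_) i
    · rw [extMatrix_mulVec_zero, hx0]; rfl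
    · rfl

theorem IsCoreExtension.e₁_mem_upperVert (h : IsCoreExtension M c B P F v s) :
    e₁ ∈ upperVert P v := by
  refine ⟨?_, by simp [e₁]⟩
  rw [e₁, coreChart_single]
  exact h.core.vertex _

/-- A point off the `ℋ`-embedding violates one of the slabs `0 ≤ x(E) ≤ 1` that contain the
`ℋ`-embedding. -/
theorem IsCoreExtension.exists_slab (h : IsCoreExtension M c B P F v s) (hP : IsPolytope P)
    (h2 : IsTwoLevel P) (hdim : dim P = (k : ℤ) + 1) {x : Fin (k + 1) → ℝ}
    (hx : coreChart v x ∉ P) :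
    ∃ E : Finset (Fin (k + 1)), E.Nonempty ∧
      (∀ y, coreChart v y ∈ P → 0 ≤ ∑ i ∈ E, y i ∧ ∑ i ∈ E, y i ≤ 1) ∧
      ¬ (0 ≤ ∑ i ∈ E, x i ∧ ∑ i ∈ E, x i ≤ 1) := by
  obtain ⟨g, hg, hgx⟩ := h2.exists_neg hP (by omega)
    (coreChart_mem_affineSpan (fun i => vert_subset (h.core.vertex i)) x) hx
  obtain ⟨E, hE⟩ := exists_edge fun i => hg _ (h.core.vertex i)
  refine ⟨E, ?_, fun y hy => ?_, ?_⟩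
  · rw [Finset.nonempty_iff_ne_empty]
    rintro rfl
    rcases hE with hE | hE <;> rw [hE] at hgx <;> norm_num at hgx
  · have := hP.mem_Icc hg hy
    rcases hE with hE | hE <;> rw [hE] at this
    · exact this
    · constructor <;> linarith [this.1, this.2]
  · rintro ⟨h0, h1⟩
    rcases hE with hE | hE <;> rw [hE] at hgx <;> linarith

/-- A lattice point of the ground set that lies in the `ℋ`-embedding is a vertex: its core slacks
are integers in `[0, 1]`. -/
theorem IsCoreExtension.mem_upperVert (h : IsCoreExtension M c B P F v s) (hP : IsPolytope P)
    (hdim : dim P = (k : ℤ) + 1) (hM : IsUnitLower M) {x : Fin (k + 1) → ℝ} (hx : x ∈ Xfull M)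
    (hxP : coreChart v x ∈ P) : x ∈ upperVert P v := by
  refine ⟨mem_extremePoints.2 ⟨hxP, ?_⟩, hM.apply_zero_of_mem_Xfull hx⟩
  obtain ⟨z, hz⟩ := hM.int_of_mem_Xfull hx
  have hIcc : ∀ i, ∀ p ∈ P, 0 ≤ s i p ∧ s i p ≤ 1 := fun i p hp =>
    hP.mem_Icc (h.slack i).zero_or_one hp
  have hint : ∀ i, ∃ a : ℤ, s i (coreChart v x) = a := by
    intro i
    have hN : ∀ j, ∃ a : ℤ, extMatrix M c i j = a := fun j => by
      rcases h.isUnitLower.zero_or_one i j with h0 | h0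
      · exact ⟨0, by simp [h0]⟩
      · exact ⟨1, by simp [h0]⟩
    choose N hN using hN
    refine ⟨∑ j, N j * z j, ?_⟩
    rw [h.slack_coreChart, hz]
    simp [Matrix.mulVec, dotProduct, hN]
  have h01 : ∀ i, s i (coreChart v x) = 0 ∨ s i (coreChart v x) = 1 := by
    intro i
    obtain ⟨a, ha⟩ := hint i
    have hb := hIcc i _ hxP
    rw [ha] at hb ⊢
    have h0 : 0 ≤ a := by exact_mod_cast hb.1
    have h1 : a ≤ 1 := by exact_mod_cast hb.2
    rcases (by omega : a = 0 ∨ a = 1) with rfl | rfl <;> simp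
  -- a convex combination of numbers in `[0, 1]` is `0` or `1` only if all of them are
  have key : ∀ p ∈ P, ∀ q ∈ P, coreChart v x ∈ openSegment ℝ p q → p = coreChart v x := by
    rintro p hp q hq ⟨a, b, ha, hb, hab, hpq⟩
    obtain ⟨y, rfl⟩ := h.exists_coreChart hdim hp
    congr 1
    refine h.isUnitLower.mulVec_injective (funext fun i => ?_)
    rw [← h.slack_coreChart, ← h.slack_coreChart]
    have hcomb : s i (coreChart v x) = a * s i (coreChart v y) + b * s i q := by
      rw [← hpq]
      exact Convex.combo_affine_apply hab
    have hp' := hIcc i _ hp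
    have hq' := hIcc i _ hq
    have hb' : b = 1 - a := by linarith
    rcases h01 i with h0 | h1
    · rw [h0] at hcomb ⊢
      nlinarith [mul_nonneg hb.le hq'.1]
    · rw [h1] at hcomb ⊢
      nlinarith [mul_nonneg hb.le (sub_nonneg.2 hq'.2)]
  intro p hp q hq hpq
  exact ⟨key p hp q hq hpq, key q hq p hp (by rwa [openSegment_symm])⟩

theorem IsCoreExtension.clDch_upperVert (h : IsCoreExtension M c B P F v s) (hP : IsPolytope P)
    (h2 : IsTwoLevel P) (hdim : dim P = (k : ℤ) + 1) (hM : IsUnitLower M) :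
    clDch M B (upperVert P v) = upperVert P v := by
  apply Set.Subset.antisymm
  · rintro x ⟨hx, hE⟩
    refine h.mem_upperVert hP hdim hM hx ?_
    by_contra hxP
    obtain ⟨E, hne, hEP, hEx⟩ := h.exists_slab hP h2 hdim hxP
    exact hEx (hE E ⟨hne, fun y hy => hEP y (vert_subset (h.coreChart_mem_vert hy))⟩)
  · exact fun x hx => ⟨h.upperVert_subset_Xfull hM hx, fun E hE => hE.2 x (Or.inr hx)⟩

/-- Every facet `F₀` of the base lies in a second facet of the `ℋ`-embedding, which is of the form
`x(E) = a` with `a ∈ {0, 1}`. -/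
theorem IsCoreExtension.exists_facet_edge (h : IsCoreExtension M c B P F v s) (hP : IsPolytope P)
    (h2 : IsTwoLevel P) (hdim : dim P = (k : ℤ) + 1) {F₀ : Set (Fin (k + 1) → ℝ)}
    (hF₀ : IsFacet B F₀) :
    ∃ (E : Finset (Fin (k + 1))) (a : ℝ), (a = 0 ∨ a = 1) ∧
      (∀ y, coreChart v y ∈ vert P → ∑ i ∈ E, y i = 0 ∨ ∑ i ∈ E, y i = 1) ∧
      (∀ y ∈ F₀, ∑ i ∈ E, y i = a) ∧ ∃ u ∈ B, ∑ i ∈ E, u i ≠ a := by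
  obtain ⟨g, hg, hFg⟩ := exists_nonneg_of_isExposed hF₀.1
  obtain ⟨u, hu, huF⟩ : ∃ u ∈ B, u ∉ F₀ := by
    by_contra! hcon
    exact hF₀.ne (Set.Subset.antisymm hF₀.subset hcon)
  have hgu : g u ≠ 0 := fun h0 => huF (by rw [hFg]; exact ⟨hu, h0⟩)
  -- a left inverse `ψ` of the chart transports `g` to the ambient space of `P`
  have hker : LinearMap.ker (coreLinear v) = ⊥ := by
    refine LinearMap.ker_eq_bot.2 fun x y hxy => h.injective ?_
    rw [coreChart_eq, coreChart_eq, hxy]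
  obtain ⟨L, hL⟩ := (coreLinear v).exists_leftInverse_of_injective hker
  let ψ : (Fin n → ℝ) →ᵃ[ℝ] (Fin (k + 1) → ℝ) :=
    L.toAffineMap - AffineMap.const ℝ _ (L (v (Fin.last (k + 1))))
  have hψ : ∀ x, ψ (coreChart v x) = x := by
    intro x
    have := LinearMap.congr_fun hL x
    simp only [LinearMap.comp_apply, LinearMap.id_apply] at this
    simp [ψ, coreChart_eq, this]
  have hB : ∀ x, x ∈ B ↔ coreChart v x ∈ {p ∈ P | s 0 p = 0} := by
    intro x
    rw [h.base_eq]
    change _ ↔ coreChart v x ∈ P ∧ s 0 (coreChart v x) = 0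
    rw [h.slack_zero]
    rfl
  have hGB : ∀ p ∈ {p ∈ P | s 0 p = 0}, ∃ x ∈ B, coreChart v x = p := by
    intro p hp
    obtain ⟨x, rfl⟩ := h.exists_coreChart hdim hp.1
    exact ⟨x, (hB x).2 hp, rfl⟩
  obtain ⟨t, ht, -, htz, htu⟩ := h2.exists_extension hP (by omega) (Set.sep_subset P _)
    (γ := s 0)
    ⟨(h.slack 0).zero_or_one, fun p hp => ⟨fun h0 => ⟨vert_subset hp, h0⟩, fun h0 => h0.2⟩⟩
    (fun p hp => hp.2) (g.comp ψ)
    (fun p hp => by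
      obtain ⟨x, hx, rfl⟩ := hGB p hp
      simpa [hψ] using hg x hx)
    ((hB u).1 hu) (by simpa [hψ] using hgu)
  have htF : ∀ y ∈ F₀, t (coreChart v y) = 0 := by
    intro y hy
    rw [hFg] at hy
    exact htz _ ((hB y).1 hy.1) (by simpa [hψ] using hy.2)
  obtain ⟨E, hE | hE⟩ := exists_edge fun i => ht _ (h.core.vertex i)
  · refine ⟨E, 0, Or.inl rfl, fun y hy => ?_, fun y hy => ?_, u, hu, ?_⟩
    · rw [← hE]; exact ht _ hy
    · rw [← hE]; exact htF y hy
    · rw [← hE]; exact htu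
  · refine ⟨E, 1, Or.inr rfl, fun y hy => ?_, fun y hy => ?_, u, hu, ?_⟩
    · have := ht _ hy
      rw [hE] at this
      rcases this with h0 | h0
      · right; linarith
      · left; linarith
    · have := htF y hy
      rw [hE] at this
      linarith
    · intro h1
      exact htu (by rw [hE, h1]; ring)

theorem IsCoreExtension.zero_mem_base (h : IsCoreExtension M c B P F v s) : 0 ∈ B := by
  rw [h.base_eq]
  refine ⟨?_, rfl⟩
  change coreChart v 0 ∈ P
  rw [coreChart_zero]
  exact vert_subset (h.core.vertex _)

theorem IsCoreExtension.single_mem_base (h : IsCoreExtension M c B P F v s) (j : Fin k) :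
    Pi.single j.succ 1 ∈ B := by
  rw [h.base_eq]
  refine ⟨?_, by simp⟩
  change coreChart v _ ∈ P
  rw [coreChart_single]
  exact vert_subset (h.core.vertex _)

theorem IsCoreExtension.not_incompatible (h : IsCoreExtension M c B P F v s) (hP : IsPolytope P)
    (h2 : IsTwoLevel P) (hdim : dim P = (k : ℤ) + 1) (hk : 0 < k) {x y z : Fin (k + 1) → ℝ}
    (hx : x ∈ vert B ∪ upperVert P v) (hy : y ∈ vert B ∪ upperVert P v)
    (hz : z ∈ vert B ∪ upperVert P v) : ¬ Incompatible B x y z := by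
  rintro ⟨F₀, hF₀, hcov⟩
  obtain ⟨E, a, ha, hE, hEF, u, hu, hua⟩ := h.exists_facet_edge hP h2 hdim hF₀
  apply hcov
  -- the base has two distinct points, so its facets are nonempty
  have hBdim : 1 ≤ dim B := by
    have hlt := dim_lt (S := {0}) (T := B) (Set.singleton_subset_iff.2 h.zero_mem_base)
      (LinearMap.proj (⟨0, hk⟩ : Fin k).succ : (Fin (k + 1) → ℝ) →ₗ[ℝ] ℝ).toAffineMap
      (by simp) (mem_affineSpan ℝ (h.single_mem_base ⟨0, hk⟩)) (by simp)
    have := dim_nonneg (Set.singleton_nonempty (0 : Fin (k + 1) → ℝ))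
    omega
  obtain ⟨p, hp⟩ : F₀.Nonempty := nonempty_of_dim_nonneg (by rw [hF₀.2]; omega)
  let f : (Fin (k + 1) → ℝ) →ₗ[ℝ] ℝ := ∑ i ∈ E, LinearMap.proj i
  have hf : ∀ q, f q = ∑ i ∈ E, q i := fun q => by simp [f]
  have hcases : (∀ q ∈ B, f q = 0) → False := fun hall =>
    hua (by rw [← hEF p hp, ← hf, ← hf, hall u hu, hall p (hF₀.subset hp)])
  have hdir : ∀ q r : Fin (k + 1) → ℝ, q - r ∈ (affineSpan ℝ F₀).direction → f q = f r := by
    intro q r hqr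
    rw [direction_affineSpan] at hqr
    have := vectorSpan_le_ker f.toAffineMap (a := a)
      (fun y hy => by change f y = a; rw [hf]; exact hEF y hy) hqr
    simpa [sub_eq_zero] using this
  have htr : ∀ q ∈ vert B ∪ upperVert P v, affTranslate F₀ q ⊆ {x | f x = 0} ∪ {x | f x = 1} := by
    intro q hq r hr
    have := hE q (h.coreChart_mem_vert hq)
    rw [← hf, ← hdir r q hr] at this
    exact this
  refine ⟨f, 0, 1, ?_, ?_, ?_⟩
  · intro h0
    exact hcases fun q _ => by rw [h0]; simp
  · intro hpair
    have h0 : {x | f x = 0} ∈ ({{x | x 0 = 0}, {x | x 0 = 1}} : Set (Set (Fin (k + 1) → ℝ))) := by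
      rw [← hpair]; exact Set.mem_insert _ _
    rcases h0 with h0 | h0
    · refine hcases fun q hq => ?_
      rw [h.base_eq] at hq
      exact h0.symm.subset hq.2
    · have : (0 : Fin (k + 1) → ℝ) ∈ {x : Fin (k + 1) → ℝ | x 0 = 1} :=
        h0.subset (by simp)
      simp at this
  · refine Set.union_subset (Set.union_subset (Set.union_subset ?_ (htr x hx)) (htr y hy)) (htr z hz)
    intro q hq
    have h1 : f q = f p := hdir q p (AffineSubspace.vsub_mem_direction hq (mem_affineSpan ℝ hp))
    rw [hf p, hEF p hp] at h1
    rcases ha with rfl | rfl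
    · exact Or.inl h1
    · exact Or.inr h1

theorem IsCoreExtension.cl_upperVert (h : IsCoreExtension M c B P F v s) (hP : IsPolytope P)
    (h2 : IsTwoLevel P) (hdim : dim P = (k : ℤ) + 1) (hM : IsUnitLower M) :
    cl M B (upperVert P v) = upperVert P v := by
  rw [cl, h.clDch_upperVert hP h2 hdim hM, clInc]
  split_ifs with hbad
  · obtain ⟨x, hx, y, hy, z, hz, hxyz⟩ := hbad
    rcases Nat.eq_zero_or_pos k with rfl | hk
    · -- for `k = 0` the only facet of the base is empty and the ground set is `{e₁}`
      refine Set.Subset.antisymm (fun x hx => ?_) (h.upperVert_subset_Xfull hM)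
      have : x = e₁ := by
        ext i
        refine Fin.cases ?_ (fun i => i.elim0) i
        rw [hM.apply_zero_of_mem_Xfull hx]
        simp [e₁]
      rw [this]
      exact h.e₁_mem_upperVert
    · exact absurd hxyz (h.not_incompatible hP h2 hdim hk hx hy hz)
  · rfl

/-- If `x(E) = b` defines a facet of the base, then on the base `x(E)` agrees with `x(E')` for a
facet of the `ℋ`-embedding, so that `E` and `E'` differ at most in the first index. -/
theorem IsCoreExtension.sum_mem_of_isFacet (h : IsCoreExtension M c B P F v s)
    (hP : IsPolytope P) (h2 : IsTwoLevel P) (hdim : dim P = (k : ℤ) + 1)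
    {E : Finset (Fin (k + 1))} (hne : E.Nonempty) (hE0 : 0 ∉ E) {b : ℝ} (hb : b = 0 ∨ b = 1)
    (hF : IsFacet B {x ∈ B | ∑ i ∈ E, x i = b}) {x : Fin (k + 1) → ℝ}
    (hx : x ∈ upperVert P v) :
    ∑ i ∈ E, x i = -1 ∨ ∑ i ∈ E, x i = 0 ∨ ∑ i ∈ E, x i = 1 := by
  classical
  obtain ⟨E', a, ha, hE', hEF, u, hu, hua⟩ := h.exists_facet_edge hP h2 hdim hF
  let φ : Finset (Fin (k + 1)) → ℝ → (Fin (k + 1) → ℝ) →ᵃ[ℝ] ℝ := fun D r =>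
    (∑ i ∈ D, LinearMap.proj i : (Fin (k + 1) → ℝ) →ₗ[ℝ] ℝ).toAffineMap - AffineMap.const ℝ _ r
  have hφ : ∀ D r y, φ D r y = ∑ i ∈ D, y i - r := fun D r y => by simp [φ]
  obtain ⟨q, hq, hqb⟩ : ∃ q ∈ B, ∑ i ∈ E, q i ≠ b := by
    by_contra! hcon
    exact hF.ne (Set.Subset.antisymm (Set.sep_subset _ _) fun q hq => ⟨hq, hcon q hq⟩)
  obtain ⟨r, hr⟩ : ∃ r : ℝ, ∀ y ∈ B, ∑ i ∈ E', y i - a = r * (∑ i ∈ E, y i - b) := by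
    refine ⟨φ E' a q / φ E b q, fun y hy => ?_⟩
    rw [← hφ E' a y, ← hφ E b y]
    exact eq_mul_of_dim hF.subset (by rw [hF.2]; omega) (φ E b) (φ E' a)
      (fun y hy => by rw [hφ, hy.2, sub_self]) (fun y hy => by rw [hφ, hEF y hy, sub_self]) hq
      (by rw [hφ]; exact sub_ne_zero.2 hqb) hy
  have hr0 : r ≠ 0 := by
    rintro rfl
    have := hr u hu
    rw [zero_mul, sub_eq_zero] at this
    exact hua this
  have hzero := hr 0 h.zero_mem_base
  simp only [Pi.zero_apply, Finset.sum_const_zero, zero_sub] at hzero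
  have hsum : ∀ (D : Finset (Fin (k + 1))) (j : Fin (k + 1)),
      ∑ i ∈ D, (Pi.single j 1 : Fin (k + 1) → ℝ) i = if j ∈ D then 1 else 0 := by
    intro D j
    simp [Pi.single_apply]
  have hsingle : ∀ j : Fin k, (if j.succ ∈ E' then (1 : ℝ) else 0) - a =
      r * ((if j.succ ∈ E then 1 else 0) - b) := by
    intro j
    have := hr _ (h.single_mem_base j)
    rwa [hsum, hsum] at this
  -- the proportionality factor is `1`, by evaluation at `0` and at the unit vectors
  have hr1 : r = 1 := by
    rcases hb with rfl | rfl
    · obtain ⟨i, hi⟩ := hne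
      obtain ⟨j, rfl⟩ := Fin.exists_succ_eq.2 (fun h0 : i = 0 => hE0 (h0 ▸ hi))
      have h1 := hsingle j
      rw [if_pos hi] at h1
      split_ifs at h1 <;> [linarith; exact absurd (by linarith) hr0]
    · rcases ha with rfl | rfl
      · exact absurd (by linarith) hr0
      · linarith
  subst hr1
  have hab : a = b := by linarith
  subst hab
  have hiff : ∀ j : Fin k, j.succ ∈ E' ↔ j.succ ∈ E := by
    intro j
    have := hsingle j
    split_ifs at this with h1 h3 h3
    · simp [h1, h3]
    · exfalso; linarith
    · exfalso; linarith
    · simp [h1, h3]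
  have hEE : E'.erase 0 = E := by
    ext i
    refine Fin.cases ?_ (fun j => ?_) i
    · simp [hE0]
    · simp [hiff]
  have h01 := hE' x hx.1
  by_cases h0 : (0 : Fin (k + 1)) ∈ E'
  · rw [← Finset.add_sum_erase _ _ h0, hEE, hx.2] at h01
    rcases h01 with h01 | h01
    · left; linarith
    · right; left; linarith
  · rw [Finset.erase_eq_of_notMem h0] at hEE
    rw [← hEE]
    exact Or.inr h01

theorem IsCoreExtension.upperVert_subset_reducedX (h : IsCoreExtension M c B P F v s)
    (hP : IsPolytope P) (h2 : IsTwoLevel P) (hdim : dim P = (k : ℤ) + 1) (hM : IsUnitLower M) :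
    upperVert P v ⊆ reducedX M B := by
  intro x hx
  refine ⟨⟨h.upperVert_subset_Xfull hM hx, ?_⟩, ?_⟩
  · rintro E ⟨hne, hE0, ⟨-, hF⟩ | ⟨-, hF⟩⟩
    · exact h.sum_mem_of_isFacet hP h2 hdim hne hE0 (Or.inl rfl) hF hx
    · exact h.sum_mem_of_isFacet hP h2 hdim hne hE0 (Or.inr rfl) hF hx
  · -- on `{x | x 0 = 1}`, the map `extMatrix M 0` differs from the slack map by a translation
    have key : ∀ y : Fin (k + 1) → ℝ, y 0 = 1 →
        extMatrix M 0 *ᵥ y = (fun i => s i (coreChart v y)) + Fin.cons 0 (-c) := by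
      intro y hy
      ext i
      refine Fin.cases ?_ (fun i => ?_) i
      · simp [h.slack_coreChart, extMatrix_mulVec_zero]
      · simp [h.slack_coreChart, extMatrix_mulVec_succ, hy]
    rw [key x hx.2, key e₁ (by simp [e₁]), toLex_add, toLex_add, coreChart_e₁]
    exact add_le_add_left (h.lex _ hx.1 (by rw [h.slack_zero, hx.2])) _

end

end TwoLevel

theorem mainTheorem1 (k m : ℕ) (P₀ : Set (Fin m → ℝ))
    (F : Fin (k + 1) → Set (Fin m → ℝ)) (v : Fin (k + 1) → Fin m → ℝ)
    (hP₀ : TwoLevel.IsPolytope P₀) (hdim : TwoLevel.dim P₀ = (k : ℤ))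
    (h2 : TwoLevel.IsTwoLevel P₀) (hΓ : TwoLevel.IsSimplicialCore P₀ F v) :
    TwoLevel.IsCompleteFamily P₀ F v
      {A | A ⊆ TwoLevel.reducedX (TwoLevel.coreMatrix F v) (TwoLevel.base P₀ v) ∧
        TwoLevel.cl (TwoLevel.coreMatrix F v) (TwoLevel.base P₀ v) A = A} := by
  refine ⟨fun A hA x hx => (hA.1 hx).1.1, fun A hA => ?_, ?_⟩
  · -- the point `e₁` satisfies all slab inequalities, so it lies in every closed set
    have he : TwoLevel.e₁ ∈ TwoLevel.Xfull (TwoLevel.coreMatrix F v) :=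
      hΓ.isUnitLower.e₁_mem_Xfull
    rw [← hA.2, TwoLevel.cl, TwoLevel.clInc]
    split_ifs
    · exact he
    · refine ⟨he, fun E _ => ?_⟩
      have : ∑ i ∈ E, (TwoLevel.e₁ : Fin (k + 1) → ℝ) i = if 0 ∈ E then 1 else 0 := by
        simp [TwoLevel.e₁, Pi.single_apply]
      rw [this]
      split_ifs <;> norm_num
  · rintro n P hP hPdim hP2 ⟨G, hG, hiso⟩
    obtain ⟨c, F', v', s, h⟩ :=
      TwoLevel.exists_isCoreExtension hP₀ hdim h2 hΓ hP hPdim hP2 hG hiso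
    exact ⟨TwoLevel.upperVert P v',
      ⟨h.upperVert_subset_reducedX hP hP2 hPdim hΓ.isUnitLower,
        h.cl_upperVert hP hP2 hPdim hΓ.isUnitLower⟩,
      F', v', h.core, h.hEmbedding_eq hP hPdim⟩
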